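/- Let $T>0$. For $N=1,2,\dots$ put $\Delta t=T/N$, let $\mu^N$ be the law $N(0,\Delta t\, I)$ on $\mathbb{R}^N$, let $\Delta W_1,\dots,\Delta W_N$ be the coordinates, and $\mathcal{G}^N_l=\sigma(\Delta W_1,\dots,\Delta W_l)$. Let $H_m(x)=\frac{(-1)^m}{\sqrt{m!}}e^{x^2/2}\frac{d^m}{dx^m}e^{-x^2/2}$ and $H_k^N=\prod_{i=1}^N H_{k_i}(\Delta W_i/\sqrt{\Delta t})$ for $k\in\mathbb{Z}_+^N$, $|k|=k_1+\dots+k_N$. A generalized functional $X$ of the increments is given by its generalized expectations $E[XP]$ against polynomials $P$ in the increments; put $J_nX=\sum_{|k|=n}E[XH^N_k]H^N_k$, $\|X\|_{2,s}^2=\sum_{n\ge 0}(1+n)^s\|J_nX\|_{L^2(\mu^N)}^2$, $\mathbb{D}^{(N)}_{2,s}=\{X:\|X\|_{2,s}<\infty\}$ (the completion of $L^2(\mu^N)$ under $\|\cdot\|_{2,s}$ if $s\le 0$), and $\mathbb{D}^{(N)}_{2,-\infty}=\bigcup_{s<0}\mathbb{D}^{(N)}_{2,s}$. Partial derivatives are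 taken in the distribution sense, i.e. $E[(\partial_lX)P]=E[X(\tfrac{\Delta W_l}{\Delta t}P-\partial_lP)]$, and $E[X|\mathcal{G}^N_{l}]$ is the $\mathcal{G}^N_{l}$-measurable $Y$ with $E[XZ]=E[YZ]$ for all polynomials $Z$ in $\Delta W_1,\dots,\Delta W_l$. Let $0\le s\le 1$ and let $F^N\in\mathbb{D}^{(N)}_{2,-\infty}$, $N=1,2,\dots$, satisfy $\sup_N\|F^N\|_{2,s}<\infty$ and the finite-dimensional property $$\sup_{k_1+\dots+k_N=n}\big(E[\partial_1^{k_1}\cdots\partial_N^{k_N}F^N]\big)^2=O\Big(\frac{n!\,\|J_nF^N\|_{L^2}^2}{T^n}\Big)\quad\text{uniformly in } n=2,3,\dots\text{ as }N\to\infty .$$ Then, for every $N\geq 1$, $F^N$ and all $E[\partial_lF^N|\mathcal{G}^N_{l-1}]$ are in $L^2(\mu^N)$, and the first-order martingale representation error $$\text{1-Mart.Err}(F^N)=F^N-E[F^N]-\sum_{l=1}^N E[\partial_lF^N|\mathcal{G}^N_{l-1}]\,\Delta W_l$$ satisfies, for some constant $C$ independent of $N$, $$\|\text{1-Mart.Err}(F^N)\|_{L^2}^2\le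 C\,N^{-s}\quad\text{for all }N\ge1,$$ so that $\|\text{1-Mart.Err}(F^N)\|_{L^2}=O(N^{-s/2})$ as $N\to\infty$. -/

import Mathlib

open MeasureTheory ProbabilityTheory
open scoped NNReal ENNReal

namespace DiscreteWiener

noncomputable section

/-- The law `μ^N = N(0, δ I)` on `ℝ^N` of the increments `(ΔW_1, …, ΔW_N)`, where `δ = Δt`.
The coordinate map `x ↦ x l` plays the role of `ΔW_{l+1}`. -/
def wienerMeasure (N : ℕ) (δ : ℝ≥0) : Measure (Fin N → ℝ) :=
  Measure.pi fun _ => gaussianReal 0 δ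

/-- Generalized functionals of the increments, as linear functionals on the space of polynomials
in the increments: `X P` is the generalized expectation `E[X P]`. The space of polynomials is
dense in every Sobolev space over `μ^N`, so an element of any of these spaces is determined by
its values on polynomials; the Sobolev spaces are carved out by `sobolevNormSq` below. -/
abbrev GenFunctional (N : ℕ) : Type := Module.Dual ℝ (MvPolynomial (Fin N) ℝ)

/-- The generalized expectation `E[X]`. -/
def expect {N : ℕ} (X : GenFunctional N) : ℝ := X 1

/-- The Gaussian adjoint `P ↦ (x_l / δ) P - ∂_l P` of the partial derivative: for the density
`p` of `μ^N` one has `-∂_l (P p) = ((x_l / δ) P - ∂_l P) p`. -/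
def derivAdjoint {N : ℕ} (δ : ℝ≥0) (l : Fin N) :
    MvPolynomial (Fin N) ℝ →ₗ[ℝ] MvPolynomial (Fin N) ℝ :=
  LinearMap.mulLeft ℝ (MvPolynomial.C ((δ : ℝ)⁻¹) * MvPolynomial.X l) -
    (MvPolynomial.pderiv l).toLinearMap

/-- The distributional partial derivative `∂_l`, characterized by
`⟨∂_l X, P p⟩ = - ⟨X, ∂_l (P p)⟩`. -/
def partialDeriv {N : ℕ} (δ : ℝ≥0) (l : Fin N) : Module.End ℝ (GenFunctional N) :=
  (derivAdjoint δ l).dualMap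

/-- The mixed derivative `∂_1^{k_1} ⋯ ∂_N^{k_N}`. -/
def mixedDeriv {N : ℕ} (δ : ℝ≥0) (k : Fin N → ℕ) : Module.End ℝ (GenFunctional N) :=
  ((List.finRange N).map fun l => partialDeriv δ l ^ k l).prod

/-- The product `∏ i, H_{k_i}(x_i / √δ)` of normalized Hermite polynomials
`H_m = (-1)^m / √(m!) · e^{x²/2} (d/dx)^m e^{-x²/2}`. -/
def hermiteProd {N : ℕ} (δ : ℝ≥0) (k : Fin N → ℕ) : MvPolynomial (Fin N) ℝ :=
  ∏ i, MvPolynomial.C ((Real.sqrt ((k i).factorial : ℝ))⁻¹) *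
    Polynomial.aeval (MvPolynomial.C ((Real.sqrt (δ : ℝ))⁻¹) * MvPolynomial.X i)
      (Polynomial.hermite (k i))

/-- The component `J_n X` of `X` in the `n`-th chaos. -/
def chaosProj {N : ℕ} (δ : ℝ≥0) (n : ℕ) (X : GenFunctional N) : MvPolynomial (Fin N) ℝ :=
  ∑ k ∈ Finset.piAntidiag (Finset.univ : Finset (Fin N)) n, X (hermiteProd δ k) • hermiteProd δ k

/-- `‖J_n X‖²`, the squared norm in `L²(μ^N)`. -/
def chaosNormSq {N : ℕ} (δ : ℝ≥0) (n : ℕ) (X : GenFunctional N) : ℝ :=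
  ∫ x, (MvPolynomial.eval x (chaosProj δ n X)) ^ 2 ∂wienerMeasure N δ

/-- `‖X‖²_{2,s} = ∑ n, (1+n)^s ‖J_n X‖²`, possibly infinite. -/
def sobolevNormSq {N : ℕ} (δ : ℝ≥0) (s : ℝ) (X : GenFunctional N) : ℝ≥0∞ :=
  ∑' n : ℕ, ENNReal.ofReal ((1 + (n : ℝ)) ^ s * chaosNormSq δ n X)

/-- The Sobolev space `𝔻_{2,s}` over `μ^N`. -/
def sobolevSpace (N : ℕ) (δ : ℝ≥0) (s : ℝ) : Set (GenFunctional N) :=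
  {X | sobolevNormSq δ s X < ∞}

/-- `𝔻_{2,-∞} = ⋃_{s<0} 𝔻_{2,s}`. -/
def sobolevSpaceNegInf (N : ℕ) (δ : ℝ≥0) : Set (GenFunctional N) :=
  ⋃ s ∈ Set.Iio (0 : ℝ), sobolevSpace N δ s

/-- The generalized functional `X` is the function `f ∈ L²(μ^N)`. -/
def IsRepresentedBy {N : ℕ} (δ : ℝ≥0) (X : GenFunctional N) (f : (Fin N → ℝ) → ℝ) : Prop :=
  MemLp f 2 (wienerMeasure N δ) ∧
    ∀ P : MvPolynomial (Fin N) ℝ, X P = ∫ x, f x * MvPolynomial.eval x P ∂wienerMeasure N δ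

/-- The sigma-algebra generated by the coordinates `i < l` (the increments preceding the one
indexed by `l`). -/
abbrev pastSigma {N : ℕ} (l : Fin N) : MeasurableSpace (Fin N → ℝ) :=
  ⨆ i : {i : Fin N // i < l}, MeasurableSpace.comap (fun x => x i) inferInstance

/-- `Y` is the (generalized) conditional expectation of `X` given the increments preceding the
one indexed by `l`, and is square integrable: `Y` is measurable in the past and
`E[X Z] = E[Y Z]` for every test function `Z` of the past. -/
def IsCondExpPast {N : ℕ} (δ : ℝ≥0) (X : GenFunctional N) (l : Fin N)
    (Y : (Fin N → ℝ) → ℝ) : Prop :=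
  Measurable[pastSigma l] Y ∧ MemLp Y 2 (wienerMeasure N δ) ∧
    ∀ P ∈ MvPolynomial.supported ℝ {i : Fin N | i < l},
      X P = ∫ x, Y x * MvPolynomial.eval x P ∂wienerMeasure N δ

/-- `e` is a version of the first order martingale representation error
`X - E[X] - ∑ l, E[∂_l X | past of l] ΔW_l`. -/
def IsFirstMartErr {N : ℕ} (δ : ℝ≥0) (X : GenFunctional N) (e : (Fin N → ℝ) → ℝ) : Prop :=
  ∃ (f : (Fin N → ℝ) → ℝ) (Y : Fin N → (Fin N → ℝ) → ℝ),
    IsRepresentedBy δ X f ∧ (∀ l, IsCondExpPast δ (partialDeriv δ l X) l (Y l)) ∧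
      e =ᵐ[wienerMeasure N δ] fun x => f x - expect X - ∑ l, Y l x * x l

/-- The finite-dimensional property of a sequence `F^N` of functionals of the `N` increments with
step `Δt = T / N`: uniformly in `n = 2, 3, …` as `N → ∞`,
`sup_{|k| = n} E[∂^k F^N]² = O(n! ‖J_n F^N‖² / T^n)`. -/
def FiniteDimensionalProperty (T : ℝ≥0) (F : (N : ℕ+) → GenFunctional (N : ℕ)) : Prop :=
  ∃ C : ℝ, ∀ᶠ N : ℕ+ in Filter.atTop, ∀ n : ℕ, 2 ≤ n → ∀ k : Fin (N : ℕ) → ℕ, ∑ i, k i = n →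
    (expect (mixedDeriv (T / (N : ℕ)) k (F N))) ^ 2 ≤
      C * ((n.factorial : ℝ) * chaosNormSq (T / (N : ℕ)) n (F N) / (T : ℝ) ^ n)

end

end DiscreteWiener

namespace DiscreteWiener

noncomputable section

/-! ### Hermite polynomials and the one-dimensional Gaussian measure -/

/-! The Hermite products are an orthonormal basis of `L²`: they span the polynomials, and a square
integrable function orthogonal to all polynomials has zero Fourier transform. Since `∂_l` acts on
Hermite coefficients by raising `k l`, the term `E[∂_l F | past] ΔW_l` is exactly the part of `F`
carried by indices whose last nonzero entry sits at `l` and equals `1`. So the error keeps precisely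
the indices whose last nonzero entry is at least `2` (`IsErrIndex`), and Parseval gives its norm
(`IsFirstMartErr.hasSum`).

In chaos `n`, the finite-dimensional property says that `E[F H_k]²` is at most `C ‖J_n F‖² N^{-n}`
times the multinomial weight `n! / ∏ k_i!`. All weights add up to `N^n`, but those of error indices
only to at most `n N^{n-1}` (`sum_multWeight_isErrIndex_le`). Hence the error in chaos `n` is at
most `C (n / N) ‖J_n F‖²`. It is also at most `‖J_n F‖²`, and interpolating the two bounds gives a
factor `max C 1 * ((1 + n) / N)^s`. Summation over `n` yields `N^{-s} ‖F‖²_{2,s}`. The finitely many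
`N` not covered by the asymptotic hypothesis are absorbed into the constant. -/

theorem derivative_hermite_succ (n : ℕ) :
    Polynomial.derivative (Polynomial.hermite (n + 1)) =
      ((n : Polynomial ℤ) + 1) * Polynomial.hermite n := by
  induction n with
  | zero => simp [Polynomial.hermite_succ]
  | succ n ih =>
    rw [Polynomial.hermite_succ (n + 1), Polynomial.derivative_sub, Polynomial.derivative_mul,
      Polynomial.derivative_X, ih, Polynomial.derivative_mul, Polynomial.hermite_succ n]
    simp only [Polynomial.derivative_add, Polynomial.derivative_natCast, Polynomial.derivative_one]
    push_cast
    ring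

theorem integrable_pow_gaussianReal (v : ℝ≥0) (n : ℕ) :
    Integrable (fun x : ℝ => x ^ n) (gaussianReal 0 v) := by
  have h := (memLp_id_gaussianReal (μ := 0) (v := v) (n : ℝ≥0)).integrable_norm_pow'
  refine (integrable_norm_iff (by fun_prop)).1 ?_
  simpa using h

theorem integrable_eval_gaussianReal (v : ℝ≥0) (p : Polynomial ℝ) :
    Integrable (fun x : ℝ => p.eval x) (gaussianReal 0 v) := by
  simp_rw [Polynomial.eval_eq_sum_range]
  exact integrable_finsetSum _ fun i _ => (integrable_pow_gaussianReal v i).const_mul _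

theorem hasDerivAt_gaussianPDFReal_std (x : ℝ) :
    HasDerivAt (gaussianPDFReal 0 1) (-(x * gaussianPDFReal 0 1 x)) x := by
  have h : HasDerivAt (fun x : ℝ => -(x - 0) ^ 2 / (2 * ((1 : ℝ≥0) : ℝ))) (-x) x := by
    have := (((hasDerivAt_id x).sub_const 0).pow 2).neg.div_const (2 * ((1 : ℝ≥0) : ℝ))
    convert! this using 1
    simp
    ring
  have := (h.exp).const_mul (Real.sqrt (2 * Real.pi * ((1 : ℝ≥0) : ℝ)))⁻¹
  rw [gaussianPDFReal_def]
  convert! this using 1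
  ring

/-- Integration by parts for polynomials and the standard Gaussian measure. -/
theorem integral_mul_eval_gaussianReal (p : Polynomial ℝ) :
    ∫ x, (Polynomial.X * p - Polynomial.derivative p).eval x ∂gaussianReal 0 1 = 0 := by
  have key : ∀ q : Polynomial ℝ, Integrable (fun x => gaussianPDFReal 0 1 x * q.eval x) := by
    intro q
    have h := integrable_eval_gaussianReal 1 q
    rw [gaussianReal_of_var_ne_zero 0 one_ne_zero] at h
    rw [integrable_withDensity_iff_integrable_smul' (measurable_gaussianPDF 0 1)
      (ae_of_all _ fun _ => gaussianPDF_lt_top)] at h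
    simpa [toReal_gaussianPDF] using h
  rw [integral_gaussianReal_eq_integral_smul one_ne_zero, ← neg_eq_zero, ← integral_neg]
  refine integral_eq_zero_of_hasDerivAt_of_integrable
    (f := fun x => gaussianPDFReal 0 1 x * p.eval x) (fun x => ?_) ?_ (key p)
  · convert! (hasDerivAt_gaussianPDFReal_std x).mul (p.hasDerivAt x) using 1
    simp
    ring
  · convert! (key (Polynomial.X * p - Polynomial.derivative p)).neg using 1

/-- The Hermite polynomial with real coefficients. -/
def hermiteReal (n : ℕ) : Polynomial ℝ := (Polynomial.hermite n).map (Int.castRingHom ℝ)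

theorem hermiteReal_zero : hermiteReal 0 = 1 := by simp [hermiteReal]

theorem hermiteReal_succ (n : ℕ) :
    hermiteReal (n + 1) =
      Polynomial.X * hermiteReal n - Polynomial.derivative (hermiteReal n) := by
  simp [hermiteReal, Polynomial.hermite_succ, Polynomial.derivative_map]

theorem derivative_hermiteReal_succ (n : ℕ) :
    Polynomial.derivative (hermiteReal (n + 1)) = ((n : Polynomial ℝ) + 1) * hermiteReal n := by
  rw [hermiteReal, Polynomial.derivative_map, derivative_hermite_succ]
  simp [hermiteReal]

/-- Raising the Hermite index is adjoint to differentiation; this drives the induction for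
orthogonality. -/
theorem integral_hermiteReal_succ_mul (n : ℕ) (p : Polynomial ℝ) :
    ∫ x, (hermiteReal (n + 1) * p).eval x ∂gaussianReal 0 1 =
      ∫ x, (hermiteReal n * Polynomial.derivative p).eval x ∂gaussianReal 0 1 := by
  have h := integral_mul_eval_gaussianReal (hermiteReal n * p)
  rw [← sub_eq_zero, ← integral_sub (integrable_eval_gaussianReal 1 _)
    (integrable_eval_gaussianReal 1 _)]
  refine Eq.trans (integral_congr_ae (ae_of_all _ fun x => ?_)) h
  dsimp only
  rw [← Polynomial.eval_sub, hermiteReal_succ, Polynomial.derivative_mul]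
  congr 1
  ring

theorem integral_hermiteReal_mul_hermiteReal (m n : ℕ) :
    ∫ x, (hermiteReal m * hermiteReal n).eval x ∂gaussianReal 0 1 =
      if m = n then (n.factorial : ℝ) else 0 := by
  induction m generalizing n with
  | zero =>
    cases n with
    | zero => simp [hermiteReal_zero]
    | succ n =>
      rw [mul_comm, integral_hermiteReal_succ_mul]
      simp [hermiteReal_zero]
  | succ m ih =>
    rw [integral_hermiteReal_succ_mul]
    cases n with
    | zero => simp [hermiteReal_zero]
    | succ n =>
      rw [derivative_hermiteReal_succ, show hermiteReal m * (((n : Polynomial ℝ) + 1) * hermiteReal n)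
        = Polynomial.C ((n : ℝ) + 1) * (hermiteReal m * hermiteReal n) by simp; ring]
      simp_rw [Polynomial.eval_mul (p := Polynomial.C _), Polynomial.eval_C]
      rw [integral_const_mul, ih]
      simp [Nat.factorial_succ]

/-- The normalized Hermite polynomial for the Gaussian measure of variance `δ`, as a function. -/
def normHermite (δ : ℝ≥0) (m : ℕ) (x : ℝ) : ℝ :=
  (Real.sqrt (m.factorial : ℝ))⁻¹ * (hermiteReal m).eval ((Real.sqrt (δ : ℝ))⁻¹ * x)

theorem normHermite_zero (δ : ℝ≥0) (x : ℝ) : normHermite δ 0 x = 1 := by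
  simp [normHermite, hermiteReal_zero]

theorem normHermite_one (δ : ℝ≥0) (x : ℝ) :
    normHermite δ 1 x = (Real.sqrt (δ : ℝ))⁻¹ * x := by
  simp [normHermite, hermiteReal]

theorem integral_normHermite_mul_normHermite {δ : ℝ≥0} (hδ : 0 < δ) (m n : ℕ) :
    ∫ x, normHermite δ m x * normHermite δ n x ∂gaussianReal 0 δ = if m = n then 1 else 0 := by
  have hmap : (gaussianReal 0 δ).map (fun x => (Real.sqrt (δ : ℝ))⁻¹ * x) = gaussianReal 0 1 := by
    rw [gaussianReal_map_const_mul]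
    congr 1
    · simp
    · ext
      simp [Real.sq_sqrt, hδ.ne']
  have h := integral_hermiteReal_mul_hermiteReal m n
  rw [← hmap, integral_map (by fun_prop)
    (Polynomial.continuous _).aestronglyMeasurable] at h
  have : ∀ x, normHermite δ m x * normHermite δ n x =
      ((Real.sqrt (m.factorial : ℝ))⁻¹ * (Real.sqrt (n.factorial : ℝ))⁻¹) *
      (hermiteReal m * hermiteReal n).eval ((Real.sqrt (δ : ℝ))⁻¹ * x) := by
    intro x
    simp [normHermite]
    ring
  simp_rw [this]
  rw [integral_const_mul, h]
  split_ifs with hmn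
  · subst hmn
    have : (0 : ℝ) < (m.factorial : ℝ) := by positivity
    rw [← mul_inv, Real.mul_self_sqrt this.le, inv_mul_cancel₀ this.ne']
  · simp

/-! ### Algebra of the Hermite products -/

variable {N : ℕ}

/-- The `i`-th factor of a Hermite product. -/
def hermiteFactor (δ : ℝ≥0) (m : ℕ) (i : Fin N) : MvPolynomial (Fin N) ℝ :=
  MvPolynomial.C ((Real.sqrt (m.factorial : ℝ))⁻¹) *
    Polynomial.aeval (MvPolynomial.C ((Real.sqrt (δ : ℝ))⁻¹) * MvPolynomial.X i)
      (Polynomial.hermite m)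

theorem hermiteProd_eq (δ : ℝ≥0) (k : Fin N → ℕ) :
    hermiteProd δ k = ∏ i, hermiteFactor δ (k i) i := rfl

theorem eval_hermiteFactor (δ : ℝ≥0) (m : ℕ) (i : Fin N) (x : Fin N → ℝ) :
    MvPolynomial.eval x (hermiteFactor δ m i) = normHermite δ m (x i) := by
  rw [hermiteFactor, normHermite, map_mul, MvPolynomial.eval_C, hermiteReal]
  congr 1
  rw [Polynomial.aeval_def, Polynomial.hom_eval₂, Polynomial.eval_map]
  congr 1
  · ext; simp
  · simp

theorem eval_hermiteProd (δ : ℝ≥0) (k : Fin N → ℕ) (x : Fin N → ℝ) :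
    MvPolynomial.eval x (hermiteProd δ k) = ∏ i, normHermite δ (k i) (x i) := by
  simp [hermiteProd_eq, map_prod, eval_hermiteFactor]

theorem hermiteProd_zero (δ : ℝ≥0) : hermiteProd δ (0 : Fin N → ℕ) = 1 := by
  simp [hermiteProd]

theorem hermiteProd_update (δ : ℝ≥0) (k : Fin N → ℕ) (l : Fin N) (m : ℕ) :
    hermiteProd δ (Function.update k l m) =
      hermiteFactor δ m l * ∏ i ∈ Finset.univ.erase l, hermiteFactor δ (k i) i := by
  rw [hermiteProd_eq, ← Finset.mul_prod_erase _ _ (Finset.mem_univ l)]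
  congr 1
  · simp
  · refine Finset.prod_congr rfl fun i hi => ?_
    rw [Function.update_of_ne (Finset.ne_of_mem_erase hi)]

theorem hermiteProd_eq_mul_erase (δ : ℝ≥0) (k : Fin N → ℕ) (l : Fin N) :
    hermiteProd δ k =
      hermiteFactor δ (k l) l * ∏ i ∈ Finset.univ.erase l, hermiteFactor δ (k i) i := by
  rw [← hermiteProd_update, Function.update_eq_self]

theorem pderiv_hermiteFactor (δ : ℝ≥0) (m : ℕ) (l i : Fin N) :
    MvPolynomial.pderiv l (hermiteFactor δ m i) =
      MvPolynomial.C ((Real.sqrt (m.factorial : ℝ))⁻¹) *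
        (Polynomial.aeval (MvPolynomial.C ((Real.sqrt (δ : ℝ))⁻¹) * MvPolynomial.X i)
          (Polynomial.derivative (Polynomial.hermite m)) *
          (MvPolynomial.C ((Real.sqrt (δ : ℝ))⁻¹) *
            (Pi.single l 1 : Fin N → MvPolynomial (Fin N) ℝ) i)) := by
  have h : ∀ p : Polynomial ℤ, MvPolynomial.pderiv l
      (Polynomial.aeval (MvPolynomial.C ((Real.sqrt (δ : ℝ))⁻¹) * MvPolynomial.X i) p) =
      Polynomial.aeval
        (MvPolynomial.C ((Real.sqrt (δ : ℝ))⁻¹) * MvPolynomial.X i : MvPolynomial (Fin N) ℝ)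
        (Polynomial.derivative p) *
          (MvPolynomial.C ((Real.sqrt (δ : ℝ))⁻¹) *
            (Pi.single l 1 : Fin N → MvPolynomial (Fin N) ℝ) i) := by
    intro p
    induction p using Polynomial.induction_on' with
    | add p q hp hq => simp only [map_add, hp, hq, add_mul]
    | monomial n a =>
      rw [Polynomial.derivative_monomial, Polynomial.aeval_monomial, Polynomial.aeval_monomial]
      simp only [Derivation.leibniz, Derivation.leibniz_pow, MvPolynomial.pderiv_X,
        MvPolynomial.pderiv_C, smul_eq_mul, nsmul_eq_mul, eq_intCast,
        Derivation.map_intCast]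
      push_cast
      ring
  rw [hermiteFactor, Derivation.leibniz, MvPolynomial.pderiv_C, h]
  simp

theorem pderiv_hermiteFactor_of_ne (δ : ℝ≥0) (m : ℕ) {l i : Fin N} (h : i ≠ l) :
    MvPolynomial.pderiv l (hermiteFactor δ m i) = 0 := by
  simp [pderiv_hermiteFactor, Pi.single_eq_of_ne h]

theorem pderiv_prod_erase (δ : ℝ≥0) (k : Fin N → ℕ) (l : Fin N) :
    MvPolynomial.pderiv l (∏ i ∈ Finset.univ.erase l, hermiteFactor δ (k i) i) = 0 := by
  refine Finset.prod_induction _ (fun P => MvPolynomial.pderiv l P = 0)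
    (fun P Q hP hQ => ?_) (Derivation.map_one_eq_zero _)
    fun i hi => pderiv_hermiteFactor_of_ne δ _ (Finset.ne_of_mem_erase hi)
  rw [Derivation.leibniz, hP, hQ, smul_zero, smul_zero, add_zero]

theorem inv_sqrt_factorial (m : ℕ) :
    (Real.sqrt (m.factorial : ℝ))⁻¹ =
      Real.sqrt ((m : ℝ) + 1) * (Real.sqrt ((m + 1).factorial : ℝ))⁻¹ := by
  have : Real.sqrt ((m : ℝ) + 1) ≠ 0 := by positivity
  rw [Nat.factorial_succ, Nat.cast_mul, Real.sqrt_mul (by positivity)]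
  push_cast
  field_simp

theorem inv_eq_inv_sqrt_mul {δ : ℝ≥0} :
    (δ : ℝ)⁻¹ = (Real.sqrt (δ : ℝ))⁻¹ * (Real.sqrt (δ : ℝ))⁻¹ := by
  rw [← mul_inv, Real.mul_self_sqrt δ.coe_nonneg]

/-- The recursion `H_{m+1} = x H_m - H_m'` after rescaling: writing `δ⁻¹` as a square, one factor
`δ^{-1/2}` goes into the argument and the other stays as coefficient. -/
theorem derivAdjoint_hermiteFactor (δ : ℝ≥0) (m : ℕ) (l : Fin N) :
    derivAdjoint δ l (hermiteFactor δ m l) =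
      MvPolynomial.C (Real.sqrt ((m : ℝ) + 1) * (Real.sqrt (δ : ℝ))⁻¹) *
        hermiteFactor δ (m + 1) l := by
  rw [derivAdjoint, LinearMap.sub_apply, LinearMap.mulLeft_apply, Derivation.coeFn_coe,
    pderiv_hermiteFactor, hermiteFactor, hermiteFactor, inv_sqrt_factorial m,
    Polynomial.hermite_succ, inv_eq_inv_sqrt_mul]
  simp only [map_sub, map_mul, Polynomial.aeval_X, Pi.single_eq_same]
  ring

theorem derivAdjoint_hermiteProd (δ : ℝ≥0) (k : Fin N → ℕ) (l : Fin N) :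
    derivAdjoint δ l (hermiteProd δ k) =
      (Real.sqrt ((k l : ℝ) + 1) * (Real.sqrt (δ : ℝ))⁻¹) •
        hermiteProd δ (Function.update k l (k l + 1)) := by
  have h := derivAdjoint_hermiteFactor δ (k l) l
  rw [hermiteProd_update, hermiteProd_eq_mul_erase δ k l, MvPolynomial.smul_eq_C_mul, ← mul_assoc,
    ← h]
  simp only [derivAdjoint, LinearMap.sub_apply, LinearMap.mulLeft_apply, Derivation.coeFn_coe,
    Derivation.leibniz, pderiv_prod_erase, smul_eq_mul]
  ring

theorem partialDeriv_hermiteProd (δ : ℝ≥0) (X : GenFunctional N) (k : Fin N → ℕ) (l : Fin N) :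
    partialDeriv δ l X (hermiteProd δ k) =
      Real.sqrt ((k l : ℝ) + 1) * (Real.sqrt (δ : ℝ))⁻¹ *
        X (hermiteProd δ (Function.update k l (k l + 1))) := by
  rw [partialDeriv, LinearMap.dualMap_apply, derivAdjoint_hermiteProd, map_smul, smul_eq_mul]

theorem partialDeriv_pow_hermiteProd (δ : ℝ≥0) (X : GenFunctional N) (j : Fin N → ℕ) (l : Fin N)
    (hj : j l = 0) (m : ℕ) :
    (partialDeriv δ l ^ m) X (hermiteProd δ j) =
      Real.sqrt (m.factorial : ℝ) * (Real.sqrt (δ : ℝ))⁻¹ ^ m *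
        X (hermiteProd δ (Function.update j l m)) := by
  induction m generalizing X with
  | zero => simp [show Function.update j l 0 = j by rw [← hj, Function.update_eq_self]]
  | succ m ih =>
    -- The innermost derivative is split off, so the induction hypothesis is applied to
    -- `partialDeriv δ l X`.
    rw [pow_succ, Module.End.mul_apply, ih, partialDeriv_hermiteProd]
    simp only [Function.update_self, Function.update_idem]
    rw [Nat.factorial_succ, Nat.cast_mul, Real.sqrt_mul (by positivity)]
    push_cast
    ring

/-- Each derivative fills one entry of the index, so the induction needs an arbitrary `j` vanishing
on the remaining list; only `j = 0` is used later. -/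
theorem list_prod_partialDeriv_hermiteProd (δ : ℝ≥0) (X : GenFunctional N) (k : Fin N → ℕ)
    (L : List (Fin N)) (hL : L.Nodup) (j : Fin N → ℕ) (hj : ∀ l ∈ L, j l = 0) :
    (L.map fun l => partialDeriv δ l ^ k l).prod X (hermiteProd δ j) =
      (L.map fun l => Real.sqrt ((k l).factorial : ℝ) * (Real.sqrt (δ : ℝ))⁻¹ ^ k l).prod *
        X (hermiteProd δ fun i => if i ∈ L then k i else j i) := by
  induction L generalizing j with
  | nil => simp
  | cons a L ih =>
    have ha : a ∉ L := (List.nodup_cons.1 hL).1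
    rw [List.map_cons, List.prod_cons, Module.End.mul_apply,
      partialDeriv_pow_hermiteProd _ _ _ _ (hj a (by simp)), ih (List.nodup_cons.1 hL).2]
    · rw [List.map_cons, List.prod_cons]
      have : (fun i => if i ∈ L then k i else Function.update j a (k a) i) =
          fun i => if i ∈ a :: L then k i else j i := ?_
      · rw [this]; ring
      ext i
      by_cases hi : i = a
      · subst hi; simp [ha]
      · simp [hi, Function.update_of_ne]
    · intro l hl
      rw [Function.update_of_ne (by rintro rfl; exact ha hl)]
      exact hj l (by simp [hl])

theorem expect_mixedDeriv (δ : ℝ≥0) (X : GenFunctional N) (k : Fin N → ℕ) :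
    expect (mixedDeriv δ k X) =
      (∏ l, Real.sqrt ((k l).factorial : ℝ) * (Real.sqrt (δ : ℝ))⁻¹ ^ k l) *
        X (hermiteProd δ k) := by
  rw [expect, mixedDeriv, ← hermiteProd_zero δ,
    list_prod_partialDeriv_hermiteProd δ X k _ (List.nodup_finRange N) 0 (by simp)]
  simp [← List.prod_ofFn, List.ofFn_eq_map]

theorem sq_expect_mixedDeriv (δ : ℝ≥0) (X : GenFunctional N) (k : Fin N → ℕ) :
    expect (mixedDeriv δ k X) ^ 2 =
      (∏ l, ((k l).factorial : ℝ)) * (δ : ℝ)⁻¹ ^ (∑ l, k l) * X (hermiteProd δ k) ^ 2 := by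
  rw [expect_mixedDeriv, mul_pow, ← Finset.prod_pow, ← Finset.prod_pow_eq_pow_sum,
    ← Finset.prod_mul_distrib]
  congr 1
  refine Finset.prod_congr rfl fun l _ => ?_
  rw [mul_pow, Real.sq_sqrt (by positivity), inv_eq_inv_sqrt_mul]
  ring

/-! ### Hermite products span the polynomials -/

/-- Three-term recurrence: multiplication by `x_l` is `δ` times the sum of the raising operator
`derivAdjoint` and the lowering operator `∂_l`. -/
theorem hermiteFactor_mul_X {δ : ℝ≥0} (hδ : 0 < δ) (m : ℕ) (l : Fin N) :
    ∃ a b : ℝ, hermiteFactor δ m l * MvPolynomial.X l =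
      MvPolynomial.C a * hermiteFactor δ (m + 1) l +
        MvPolynomial.C b * hermiteFactor δ (m - 1) l := by
  have hδ' : (δ : ℝ) ≠ 0 := by exact_mod_cast hδ.ne'
  have h1 : hermiteFactor δ m l * MvPolynomial.X l =
      MvPolynomial.C (δ : ℝ) * (derivAdjoint δ l (hermiteFactor δ m l) +
        MvPolynomial.pderiv l (hermiteFactor δ m l)) := by
    simp only [derivAdjoint, LinearMap.sub_apply, LinearMap.mulLeft_apply, Derivation.coeFn_coe,
      sub_add_cancel]
    rw [← mul_assoc, ← mul_assoc, ← map_mul, mul_inv_cancel₀ hδ']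
    simp [mul_comm]
  obtain ⟨b, hb⟩ : ∃ b : ℝ, MvPolynomial.pderiv l (hermiteFactor δ m l) =
      MvPolynomial.C b * hermiteFactor δ (m - 1) l := by
    cases m with
    -- Here the truncated `m - 1` is again `0`, which is harmless because the coefficient vanishes.
    | zero => exact ⟨0, by simp [pderiv_hermiteFactor]⟩
    | succ m =>
      refine ⟨Real.sqrt ((m : ℝ) + 1) * (Real.sqrt (δ : ℝ))⁻¹, ?_⟩
      have hs : (m : ℝ) + 1 = Real.sqrt ((m : ℝ) + 1) * Real.sqrt ((m : ℝ) + 1) :=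
        (Real.mul_self_sqrt (by positivity)).symm
      have hc : ((m : MvPolynomial (Fin N) ℝ) + 1) =
          MvPolynomial.C (Real.sqrt ((m : ℝ) + 1)) * MvPolynomial.C (Real.sqrt ((m : ℝ) + 1)) := by
        rw [← map_mul, ← hs]; simp
      rw [pderiv_hermiteFactor, derivative_hermite_succ, Nat.add_sub_cancel, hermiteFactor,
        inv_sqrt_factorial m]
      simp only [map_mul, map_add, map_natCast, map_one, Pi.single_eq_same, hc]
      ring
  refine ⟨δ * (Real.sqrt ((m : ℝ) + 1) * (Real.sqrt (δ : ℝ))⁻¹), δ * b, ?_⟩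
  rw [h1, derivAdjoint_hermiteFactor, hb]
  simp only [map_mul]
  ring

/-- Polynomials in the variables indexed by `s` are spanned by the Hermite products in these
variables. -/
theorem mem_span_hermiteProd {δ : ℝ≥0} (hδ : 0 < δ) (s : Set (Fin N))
    {P : MvPolynomial (Fin N) ℝ} (hP : P ∈ MvPolynomial.supported ℝ s) :
    P ∈ Submodule.span ℝ (hermiteProd δ '' {k : Fin N → ℕ | ∀ i, i ∉ s → k i = 0}) := by
  rw [MvPolynomial.supported_eq_range_rename] at hP
  obtain ⟨Q, rfl⟩ := hP
  induction Q using MvPolynomial.induction_on with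
  | C a =>
    have : MvPolynomial.C a = a • hermiteProd δ (0 : Fin N → ℕ) := by
      rw [hermiteProd_zero, MvPolynomial.smul_eq_C_mul, mul_one]
    simp only [AlgHom.toRingHom_eq_coe, RingHom.coe_coe, MvPolynomial.rename_C, this]
    exact Submodule.smul_mem _ _ (Submodule.subset_span ⟨0, by simp, rfl⟩)
  | add p q hp hq =>
    simp only [AlgHom.toRingHom_eq_coe, RingHom.coe_coe, map_add] at *
    exact Submodule.add_mem _ hp hq
  | mul_X p l hp =>
    simp only [AlgHom.toRingHom_eq_coe, RingHom.coe_coe, map_mul, MvPolynomial.rename_X] at *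
    generalize (MvPolynomial.rename Subtype.val) p = R at hp ⊢
    induction hp using Submodule.span_induction with
    | zero => simp
    | add a b _ _ ha hb => rw [add_mul]; exact Submodule.add_mem _ ha hb
    | smul c a _ ha => rw [smul_mul_assoc]; exact Submodule.smul_mem _ _ ha
    | mem a ha =>
      obtain ⟨k, hk, rfl⟩ := ha
      obtain ⟨c, d, h⟩ := hermiteFactor_mul_X hδ (k l) (l : Fin N)
      have : hermiteProd δ k * MvPolynomial.X (l : Fin N) =
          c • hermiteProd δ (Function.update k l (k l + 1)) +
            d • hermiteProd δ (Function.update k l (k l - 1)) := by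
        rw [hermiteProd_update, hermiteProd_update, hermiteProd_eq_mul_erase δ k l, mul_right_comm,
          h, MvPolynomial.smul_eq_C_mul, MvPolynomial.smul_eq_C_mul]
        ring
      have hmem : ∀ m, Function.update k (l : Fin N) m ∈
          {k : Fin N → ℕ | ∀ i, i ∉ s → k i = 0} := by
        intro m i hi
        rw [Function.update_of_ne (by rintro rfl; exact hi l.2)]
        exact hk i hi
      rw [this]
      exact Submodule.add_mem _
        (Submodule.smul_mem _ _ (Submodule.subset_span ⟨_, hmem _, rfl⟩))
        (Submodule.smul_mem _ _ (Submodule.subset_span ⟨_, hmem _, rfl⟩))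

/-! ### The Hermite basis of `L²` -/

instance isProbabilityMeasure_wienerMeasure (N : ℕ) (δ : ℝ≥0) :
    IsProbabilityMeasure (wienerMeasure N δ) := by
  unfold wienerMeasure
  infer_instance

theorem integrable_eval (δ : ℝ≥0) (P : MvPolynomial (Fin N) ℝ) :
    Integrable (fun x => MvPolynomial.eval x P) (wienerMeasure N δ) := by
  induction P using MvPolynomial.induction_on' with
  | monomial u a =>
    simp only [MvPolynomial.eval_monomial]
    refine Integrable.const_mul ?_ _
    simp only [Finsupp.prod_pow]
    exact Integrable.fintype_prod fun i => integrable_pow_gaussianReal δ (u i)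
  | add p q hp hq =>
    simp only [map_add]
    exact hp.add hq

theorem memLp_eval (δ : ℝ≥0) (P : MvPolynomial (Fin N) ℝ) :
    MemLp (fun x => MvPolynomial.eval x P) 2 (wienerMeasure N δ) := by
  rw [memLp_two_iff_integrable_sq (MvPolynomial.continuous_eval P).aestronglyMeasurable]
  exact (integrable_eval δ (P ^ 2)).congr (ae_of_all _ fun x => map_pow _ _ _)

theorem integral_hermiteProd_mul_hermiteProd {δ : ℝ≥0} (hδ : 0 < δ) (j k : Fin N → ℕ) :
    ∫ x, MvPolynomial.eval x (hermiteProd δ j) * MvPolynomial.eval x (hermiteProd δ k)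
      ∂wienerMeasure N δ = if j = k then 1 else 0 := by
  simp_rw [eval_hermiteProd, ← Finset.prod_mul_distrib]
  rw [wienerMeasure, integral_fintype_prod_eq_prod
    (f := fun i x => normHermite δ (j i) x * normHermite δ (k i) x)]
  simp_rw [integral_normHermite_mul_normHermite hδ]
  split_ifs with h
  · simp [h]
  · obtain ⟨i, hi⟩ := Function.ne_iff.1 h
    exact Finset.prod_eq_zero (Finset.mem_univ i) (if_neg hi)

theorem integrable_exp_sum_abs (δ : ℝ≥0) (t : Fin N → ℝ) :
    Integrable (fun x => Real.exp (∑ i, t i * |x i|)) (wienerMeasure N δ) := by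
  simp_rw [Real.exp_sum]
  exact Integrable.fintype_prod (f := fun i y => Real.exp (t i * |y|)) fun i =>
    integrable_exp_mul_abs (integrable_exp_mul_gaussianReal _) (integrable_exp_mul_gaussianReal _)

/-- The exponential of the absolute value of a linear form is square integrable. -/
theorem memLp_exp_abs (δ : ℝ≥0) (c : Fin N → ℝ) :
    MemLp (fun x => Real.exp |∑ i, c i * x i|) 2 (wienerMeasure N δ) := by
  rw [memLp_two_iff_integrable_sq (Continuous.aestronglyMeasurable (by fun_prop))]
  refine (integrable_exp_sum_abs δ fun i => 2 * |c i|).mono'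
    (Continuous.aestronglyMeasurable (by fun_prop)) (ae_of_all _ fun x => ?_)
  rw [Real.norm_of_nonneg (by positivity), ← Real.exp_nat_mul]
  gcongr
  push_cast
  simp_rw [mul_assoc, ← Finset.mul_sum, ← abs_mul]
  gcongr
  exact Finset.abs_sum_le_sum_abs _ _

/-- The Fourier transform of a square integrable function orthogonal to all polynomials
vanishes. -/
theorem integral_cexp_eq_zero {δ : ℝ≥0} {g : (Fin N → ℝ) → ℝ}
    (hg : MemLp g 2 (wienerMeasure N δ))
    (h0 : ∀ P : MvPolynomial (Fin N) ℝ,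
      ∫ x, g x * MvPolynomial.eval x P ∂wienerMeasure N δ = 0) (c : Fin N → ℝ) :
    ∫ x, (g x : ℂ) * Complex.exp ((∑ i, c i * x i : ℝ) * Complex.I) ∂wienerMeasure N δ = 0 := by
  -- The exponential is expanded and integrated termwise. The dominating series sums to `|g| exp
  -- |c·x|`, integrable as a product of two `L²` functions.
  have hsum := hasSum_integral_of_dominated_convergence (μ := wienerMeasure N δ)
    (F := fun (n : ℕ) x =>
      (g x : ℂ) * ((((∑ i, c i * x i : ℝ) : ℂ) * Complex.I) ^ n / (n.factorial : ℂ)))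
    (f := fun x => (g x : ℂ) * Complex.exp ((∑ i, c i * x i : ℝ) * Complex.I))
    (fun n x => |g x| * (|∑ i, c i * x i| ^ n / (n.factorial : ℝ)))
    (fun n => ?_) (fun n => ae_of_all _ fun x => ?_) (ae_of_all _ fun x => ?_) ?_
    (ae_of_all _ fun x => ?_)
  · rw [← hsum.tsum_eq]
    refine (tsum_congr fun n => ?_).trans tsum_zero
    have hP := h0 ((∑ i, MvPolynomial.C (c i) * MvPolynomial.X i) ^ n)
    simp only [map_pow, map_sum, map_mul, MvPolynomial.eval_C, MvPolynomial.eval_X] at hP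
    have : ∀ x : Fin N → ℝ,
        (g x : ℂ) * ((((∑ i, c i * x i : ℝ) : ℂ) * Complex.I) ^ n / (n.factorial : ℂ)) =
        (Complex.I ^ n / (n.factorial : ℂ)) * ((g x * (∑ i, c i * x i) ^ n : ℝ) : ℂ) := by
      intro x
      push_cast
      ring
    simp_rw [this]
    rw [integral_const_mul, integral_complex_ofReal, hP]
    simp
  · have : AEStronglyMeasurable (fun x => (g x : ℂ)) (wienerMeasure N δ) :=
      Complex.continuous_ofReal.comp_aestronglyMeasurable hg.1
    exact this.mul (Continuous.aestronglyMeasurable (by fun_prop))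
  · rw [norm_mul, norm_div, norm_pow, norm_mul, Complex.norm_I, Complex.norm_real,
      Complex.norm_real, Complex.norm_natCast, mul_one, Real.norm_eq_abs, Real.norm_eq_abs]
  · exact (Real.summable_pow_div_factorial _).mul_left _
  · have : (fun x => ∑' n : ℕ, |g x| * (|∑ i, c i * x i| ^ n / (n.factorial : ℝ))) =
        fun x => |g x| * Real.exp |∑ i, c i * x i| := by
      ext x
      rw [tsum_mul_left, Real.exp_eq_exp_ℝ, NormedSpace.exp_eq_tsum_div]
    rw [this]
    exact (hg.abs).integrable_mul (memLp_exp_abs δ c)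
  · have := (NormedSpace.expSeries_div_hasSum_exp
      (((∑ i, c i * x i : ℝ) : ℂ) * Complex.I)).mul_left (g x : ℂ)
    rwa [← Complex.exp_eq_exp_ℂ] at this

/-- A square integrable function orthogonal to all polynomials vanishes. -/
theorem ae_eq_zero_of_forall_integral_eq_zero {δ : ℝ≥0} {g : (Fin N → ℝ) → ℝ}
    (hg : MemLp g 2 (wienerMeasure N δ))
    (h0 : ∀ P : MvPolynomial (Fin N) ℝ,
      ∫ x, g x * MvPolynomial.eval x P ∂wienerMeasure N δ = 0) :
    g =ᵐ[wienerMeasure N δ] 0 := by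
  have hgi : Integrable g (wienerMeasure N δ) := hg.integrable one_le_two
  have hfin : ∀ f : (Fin N → ℝ) → ℝ, Integrable f (wienerMeasure N δ) →
      IsFiniteMeasure ((wienerMeasure N δ).withDensity fun x => ENNReal.ofReal (f x)) :=
    fun f hf => isFiniteMeasure_withDensity_ofReal hf.2
  have := hfin g hgi
  have := hfin (fun x => - g x) hgi.neg
  have hchar : ∀ f : (Fin N → ℝ) → ℝ, Integrable f (wienerMeasure N δ) →
      ∀ u : (Fin N → ℝ) → ℂ,
      ∫ x, u x ∂((wienerMeasure N δ).withDensity fun x => ENNReal.ofReal (f x)) =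
        ∫ x, ((max (f x) 0 : ℝ) : ℂ) * u x ∂wienerMeasure N δ := by
    intro f hf u
    rw [integral_withDensity_eq_integral_toReal_smul₀ hf.1.aemeasurable.ennreal_ofReal
      (ae_of_all _ fun _ => ENNReal.ofReal_lt_top)]
    simp [ENNReal.toReal_ofReal', Complex.real_smul]
  have hpos : ∀ f : (Fin N → ℝ) → ℝ, Integrable f (wienerMeasure N δ) → ∀ c : Fin N → ℝ,
      Integrable (fun x => ((max (f x) 0 : ℝ) : ℂ) *
        Complex.exp ((∑ i, c i * x i : ℝ) * Complex.I)) (wienerMeasure N δ) := by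
    intro f hf c
    refine (hf.pos_part.ofReal (𝕜 := ℂ)).mul_bdd (c := 1)
      (Continuous.aestronglyMeasurable (by fun_prop)) (ae_of_all _ fun x => ?_)
    rw [Complex.norm_exp_ofReal_mul_I]
  -- The positive and negative parts of `g` are densities of finite measures; they agree because
  -- their characteristic functions differ by the Fourier transform of `g`, which is zero.
  have heq : (wienerMeasure N δ).withDensity (fun x => ENNReal.ofReal (g x)) =
      (wienerMeasure N δ).withDensity (fun x => ENNReal.ofReal (- g x)) := by
    refine Measure.ext_of_charFunDual (funext fun L => ?_)
    obtain ⟨c, hL⟩ : ∃ c : Fin N → ℝ, ∀ x : Fin N → ℝ, L x = ∑ i, c i * x i := by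
      refine ⟨fun i => L (Pi.single i 1), fun x => ?_⟩
      conv_lhs => rw [← Finset.univ_sum_single x, map_sum]
      refine Finset.sum_congr rfl fun i _ => ?_
      rw [show (Pi.single i (x i) : Fin N → ℝ) = x i • Pi.single i 1 by
        rw [← Pi.single_smul]; simp, map_smul, smul_eq_mul, mul_comm]
    rw [charFunDual_apply, charFunDual_apply, hchar _ hgi,
      hchar (fun x => - g x) hgi.neg]
    simp_rw [hL]
    rw [← sub_eq_zero, ← integral_sub (hpos _ hgi _) (hpos (fun x => - g x) hgi.neg _),
      ← integral_cexp_eq_zero hg h0 c]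
    refine integral_congr_ae (ae_of_all _ fun x => ?_)
    dsimp only
    rw [← sub_mul, ← Complex.ofReal_sub, max_zero_sub_max_neg_zero_eq_self]
  have hae := (withDensity_eq_iff hg.1.aemeasurable.ennreal_ofReal
    hg.1.aemeasurable.neg.ennreal_ofReal
    (ne_of_lt (hgi.lintegral_lt_top))).1 heq
  filter_upwards [hae] with x hx
  have hx' := congrArg ENNReal.toReal hx
  rw [ENNReal.toReal_ofReal', ENNReal.toReal_ofReal'] at hx'
  have := max_zero_sub_max_neg_zero_eq_self (g x)
  rw [hx', Pi.neg_apply, sub_self] at this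
  exact this.symm

/-- The Hermite products as elements of `L²`. -/
def hermiteLp (N : ℕ) (δ : ℝ≥0) (k : Fin N → ℕ) : Lp ℝ 2 (wienerMeasure N δ) :=
  (memLp_eval δ (hermiteProd δ k)).toLp

theorem inner_toLp_toLp {δ : ℝ≥0} {f g : (Fin N → ℝ) → ℝ} (hf : MemLp f 2 (wienerMeasure N δ))
    (hg : MemLp g 2 (wienerMeasure N δ)) :
    inner ℝ hf.toLp hg.toLp = ∫ x, f x * g x ∂wienerMeasure N δ := by
  rw [L2.inner_def]
  refine integral_congr_ae ?_
  filter_upwards [hf.coeFn_toLp, hg.coeFn_toLp] with x hx hy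
  rw [hx, hy]
  simp [mul_comm]

theorem orthonormal_hermiteLp {δ : ℝ≥0} (hδ : 0 < δ) : Orthonormal ℝ (hermiteLp N δ) := by
  rw [orthonormal_iff_ite]
  intro j k
  rw [hermiteLp, hermiteLp, inner_toLp_toLp, integral_hermiteProd_mul_hermiteProd hδ]

/-- Agreement on Hermite products extends by linearity. The set `s` allows both uses: all variables,
and only the past of `l`. -/
theorem integral_mul_eval_eq {δ : ℝ≥0} (hδ : 0 < δ) {g : (Fin N → ℝ) → ℝ}
    (hg : MemLp g 2 (wienerMeasure N δ)) (s : Set (Fin N)) (X : GenFunctional N)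
    (h : ∀ k : Fin N → ℕ, (∀ i, i ∉ s → k i = 0) →
      X (hermiteProd δ k) =
        ∫ x, g x * MvPolynomial.eval x (hermiteProd δ k) ∂wienerMeasure N δ)
    {P : MvPolynomial (Fin N) ℝ} (hP : P ∈ MvPolynomial.supported ℝ s) :
    X P = ∫ x, g x * MvPolynomial.eval x P ∂wienerMeasure N δ := by
  have hP' := mem_span_hermiteProd hδ s hP
  clear hP
  induction hP' using Submodule.span_induction with
  | mem a ha =>
    obtain ⟨k, hk, rfl⟩ := ha
    exact h k hk
  | zero => simp
  | add a b _ _ ha hb =>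
    simp only [map_add, mul_add]
    rw [ha, hb]
    exact (integral_add (hg.integrable_mul (memLp_eval δ a))
      (hg.integrable_mul (memLp_eval δ b))).symm
  | smul c a _ ha =>
    simp only [map_smul, smul_eq_mul, MvPolynomial.smul_eval, mul_left_comm _ c]
    rw [ha, integral_const_mul]

theorem orthogonal_span_hermiteLp {δ : ℝ≥0} (hδ : 0 < δ) :
    (Submodule.span ℝ (Set.range (hermiteLp N δ)))ᗮ = ⊥ := by
  rw [Submodule.eq_bot_iff]
  intro u hu
  rw [Submodule.mem_orthogonal] at hu
  have hu2 : MemLp u 2 (wienerMeasure N δ) := Lp.memLp u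
  rw [← Lp.toLp_coeFn u hu2] at hu
  rw [Lp.eq_zero_iff_ae_eq_zero]
  refine ae_eq_zero_of_forall_integral_eq_zero hu2 fun P => ?_
  -- Applied to the zero functional: orthogonality to Hermite products becomes orthogonality to all
  -- polynomials.
  refine (integral_mul_eval_eq hδ hu2 Set.univ 0 (fun k _ => ?_) (by simp)).symm
  have := hu (hermiteLp N δ k) (Submodule.subset_span ⟨k, rfl⟩)
  rw [hermiteLp, inner_toLp_toLp] at this
  simp_rw [mul_comm (u _), this]
  rfl

/-- The Hilbert basis of `L²` formed by the Hermite products. -/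
def hermiteBasis (N : ℕ) {δ : ℝ≥0} (hδ : 0 < δ) :
    HilbertBasis (Fin N → ℕ) ℝ (Lp ℝ 2 (wienerMeasure N δ)) :=
  HilbertBasis.mkOfOrthogonalEqBot (orthonormal_hermiteLp hδ) (orthogonal_span_hermiteLp hδ)

theorem coe_hermiteBasis {δ : ℝ≥0} (hδ : 0 < δ) : ⇑(hermiteBasis N hδ) = hermiteLp N δ :=
  HilbertBasis.coe_mkOfOrthogonalEqBot _ _

/-- Riesz–Fischer for the Hermite basis. -/
theorem exists_memLp_of_summable {δ : ℝ≥0} (hδ : 0 < δ) {c : (Fin N → ℕ) → ℝ}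
    (hc : Summable fun k => c k ^ 2) :
    ∃ f : (Fin N → ℝ) → ℝ, MemLp f 2 (wienerMeasure N δ) ∧
      ∀ k, ∫ x, f x * MvPolynomial.eval x (hermiteProd δ k) ∂wienerMeasure N δ = c k := by
  have hc2 : Memℓp c 2 := by
    rw [memℓp_gen_iff (by norm_num)]
    simpa using hc
  set u := (hermiteBasis N hδ).repr.symm ⟨c, hc2⟩ with hu
  have hu2 : MemLp u 2 (wienerMeasure N δ) := Lp.memLp u
  refine ⟨u, hu2, fun k => ?_⟩
  have h := (hermiteBasis N hδ).repr_apply_apply u k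
  rw [hu, LinearIsometryEquiv.apply_symm_apply, ← hu, coe_hermiteBasis, hermiteLp,
    ← Lp.toLp_coeFn u hu2, inner_toLp_toLp] at h
  simp_rw [mul_comm (u _), ← h]

theorem hasSum_sq_integral_hermiteProd {δ : ℝ≥0} (hδ : 0 < δ) {f : (Fin N → ℝ) → ℝ}
    (hf : MemLp f 2 (wienerMeasure N δ)) :
    HasSum (fun k => (∫ x, f x * MvPolynomial.eval x (hermiteProd δ k) ∂wienerMeasure N δ) ^ 2)
      (∫ x, f x ^ 2 ∂wienerMeasure N δ) := by
  have h := (hermiteBasis N hδ).hasSum_inner_mul_inner hf.toLp hf.toLp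
  simp_rw [coe_hermiteBasis, hermiteLp, inner_toLp_toLp] at h
  simp_rw [sq]
  simp_rw [mul_comm (MvPolynomial.eval _ _)] at h
  exact h

theorem chaosNormSq_eq {δ : ℝ≥0} (hδ : 0 < δ) (n : ℕ) (X : GenFunctional N) :
    chaosNormSq δ n X =
      ∑ k ∈ Finset.piAntidiag (Finset.univ : Finset (Fin N)) n, X (hermiteProd δ k) ^ 2 := by
  have h : ∀ x : Fin N → ℝ, MvPolynomial.eval x (chaosProj δ n X) ^ 2 =
      ∑ j ∈ Finset.piAntidiag (Finset.univ : Finset (Fin N)) n,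
        ∑ k ∈ Finset.piAntidiag (Finset.univ : Finset (Fin N)) n,
          (X (hermiteProd δ j) * X (hermiteProd δ k)) *
            (MvPolynomial.eval x (hermiteProd δ j) * MvPolynomial.eval x (hermiteProd δ k)) := by
    intro x
    rw [chaosProj, map_sum, sq, Finset.sum_mul_sum]
    refine Finset.sum_congr rfl fun j _ => Finset.sum_congr rfl fun k _ => ?_
    rw [MvPolynomial.smul_eval, MvPolynomial.smul_eval]
    ring
  have hi : ∀ j k : Fin N → ℕ, Integrable (fun x => (X (hermiteProd δ j) * X (hermiteProd δ k)) *
      (MvPolynomial.eval x (hermiteProd δ j) * MvPolynomial.eval x (hermiteProd δ k)))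
      (wienerMeasure N δ) := fun j k =>
    ((memLp_eval δ _).integrable_mul (memLp_eval δ _)).const_mul _
  simp_rw [chaosNormSq, h]
  rw [integral_finsetSum _ fun j _ => integrable_finsetSum _ fun k _ => hi j k]
  refine Finset.sum_congr rfl fun j hj => ?_
  rw [integral_finsetSum _ fun k _ => hi j k]
  simp_rw [integral_const_mul, integral_hermiteProd_mul_hermiteProd hδ]
  simp [hj, sq]

/-! ### Past and future coordinates -/

/-- The sigma-algebra generated by the coordinates in `s`. -/
abbrev coordSigma (s : Set (Fin N)) : MeasurableSpace (Fin N → ℝ) :=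
  ⨆ i ∈ s, MeasurableSpace.comap (fun x : Fin N → ℝ => x i) inferInstance

theorem pastSigma_eq (l : Fin N) : pastSigma l = coordSigma {i | i < l} := by
  rw [pastSigma, coordSigma, iSup_subtype']
  rfl

theorem coordSigma_le (s : Set (Fin N)) : coordSigma s ≤ MeasurableSpace.pi :=
  iSup₂_le fun i _ => (measurable_pi_apply i).comap_le

theorem measurable_coord {s : Set (Fin N)} {i : Fin N} (hi : i ∈ s) :
    Measurable[coordSigma s] fun x : Fin N → ℝ => x i :=
  Measurable.of_comap_le (le_iSup₂_of_le i hi le_rfl)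

theorem indep_coordSigma (δ : ℝ≥0) {s t : Set (Fin N)} (hst : Disjoint s t) :
    Indep (coordSigma s) (coordSigma t) (wienerMeasure N δ) := by
  refine indep_iSup_of_disjoint (fun i => (measurable_pi_apply i).comap_le) ?_ hst
  exact iIndepFun_pi (X := fun _ => id) fun _ => aemeasurable_id

theorem measurable_eval_of_mem_supported {s : Set (Fin N)} {P : MvPolynomial (Fin N) ℝ}
    (hP : P ∈ MvPolynomial.supported ℝ s) :
    Measurable[coordSigma s] fun x => MvPolynomial.eval x P := by
  rw [MvPolynomial.supported_eq_range_rename] at hP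
  obtain ⟨Q, rfl⟩ := hP
  simp only [AlgHom.toRingHom_eq_coe, RingHom.coe_coe, MvPolynomial.eval_rename]
  induction Q using MvPolynomial.induction_on with
  | C a => simp only [MvPolynomial.eval_C]; exact measurable_const
  | add p q hp hq => simp only [map_add]; exact hp.add hq
  | mul_X p i hp =>
    simp only [map_mul, MvPolynomial.eval_X, Function.comp_apply]
    exact hp.mul (measurable_coord i.2)

theorem hermiteProd_mem_supported (δ : ℝ≥0) {s : Set (Fin N)} {k : Fin N → ℕ}
    (hk : ∀ i, i ∉ s → k i = 0) : hermiteProd δ k ∈ MvPolynomial.supported ℝ s := by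
  refine prod_mem fun i _ => ?_
  by_cases hi : i ∈ s
  · refine mul_mem (Subalgebra.algebraMap_mem _ _) ?_
    rw [Polynomial.aeval_eq_sum_range]
    refine sum_mem fun j _ => zsmul_mem (pow_mem (mul_mem (Subalgebra.algebraMap_mem _ _) ?_) _) _
    exact MvPolynomial.X_mem_supported.2 hi
  · simp [hk i hi]

theorem indepFun_of_coordSigma (δ : ℝ≥0) {s t : Set (Fin N)} (hst : Disjoint s t)
    {Y U : (Fin N → ℝ) → ℝ} (hY : Measurable[coordSigma s] Y) (hU : Measurable[coordSigma t] U) :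
    IndepFun Y U (wienerMeasure N δ) :=
  indep_of_indep_of_le_left (indep_of_indep_of_le_right (indep_coordSigma δ hst) hU.comap_le)
    hY.comap_le

theorem disjoint_past_future (l : Fin N) : Disjoint {i : Fin N | i < l} {i : Fin N | ¬ i < l} :=
  disjoint_compl_right

/-- A product of two `L²` functions is only `L¹` in general; here independence of the past from `x
l` makes the second moments multiply. -/
theorem memLp_mul_coord {δ : ℝ≥0} {l : Fin N} {Y : (Fin N → ℝ) → ℝ}
    (hY : Measurable[pastSigma l] Y) (hY2 : MemLp Y 2 (wienerMeasure N δ)) :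
    MemLp (fun x => Y x * x l) 2 (wienerMeasure N δ) := by
  rw [pastSigma_eq] at hY
  have hx : Measurable[coordSigma {i : Fin N | ¬ i < l}] fun x : Fin N → ℝ => x l :=
    measurable_coord (by simp)
  have hx2 : MemLp (fun x : Fin N → ℝ => x l) 2 (wienerMeasure N δ) :=
    (memLp_eval δ (MvPolynomial.X l)).ae_eq (ae_of_all _ fun x => MvPolynomial.eval_X l)
  have hYx := indepFun_of_coordSigma δ (disjoint_past_future l) (hY.pow_const 2) (hx.pow_const 2)
  refine (memLp_two_iff_integrable_sq (hY2.1.mul hx2.1)).2 ?_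
  refine (hYx.integrable_mul hY2.integrable_sq hx2.integrable_sq).congr (ae_of_all _ fun x => ?_)
  simp [mul_pow]

/-- The part of a multi-index before `l`. -/
def pastIndex (l : Fin N) (k : Fin N → ℕ) : Fin N → ℕ := fun i => if i < l then k i else 0

/-- The part of a multi-index from `l` on. -/
def futureIndex (l : Fin N) (k : Fin N → ℕ) : Fin N → ℕ := fun i => if i < l then 0 else k i

theorem eval_hermiteProd_eq_mul (δ : ℝ≥0) (l : Fin N) (k : Fin N → ℕ) (x : Fin N → ℝ) :
    MvPolynomial.eval x (hermiteProd δ k) =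
      MvPolynomial.eval x (hermiteProd δ (pastIndex l k)) *
        MvPolynomial.eval x (hermiteProd δ (futureIndex l k)) := by
  simp_rw [eval_hermiteProd, ← Finset.prod_mul_distrib]
  refine Finset.prod_congr rfl fun i _ => ?_
  by_cases h : i < l <;> simp [pastIndex, futureIndex, h, normHermite_zero]

/-! ### Hermite coefficients of the martingale terms and of the error -/

theorem eval_hermiteProd_single {δ : ℝ≥0} (hδ : 0 < δ) (l : Fin N) (x : Fin N → ℝ) :
    x l = Real.sqrt δ * MvPolynomial.eval x (hermiteProd δ (Pi.single l 1)) := by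
  have h : Real.sqrt (δ : ℝ) ≠ 0 := (Real.sqrt_pos.2 hδ).ne'
  rw [eval_hermiteProd, Finset.prod_eq_single l]
  · rw [Pi.single_eq_same, normHermite_one, ← mul_assoc, mul_inv_cancel₀ h, one_mul]
  · intro i _ hi
    rw [Pi.single_eq_of_ne hi, normHermite_zero]
  · simp

/-- The integral factors by independence into a past part and a part from `l` on; the latter pairs
two Hermite products, so it is `0` or `1`. -/
theorem integral_mul_coord_mul_hermiteProd {δ : ℝ≥0} (hδ : 0 < δ) {l : Fin N}
    {Y : (Fin N → ℝ) → ℝ} (hY : Measurable[pastSigma l] Y) (k : Fin N → ℕ) :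
    ∫ x, Y x * x l * MvPolynomial.eval x (hermiteProd δ k) ∂wienerMeasure N δ =
      if futureIndex l k = Pi.single l 1 then Real.sqrt δ *
        ∫ x, Y x * MvPolynomial.eval x (hermiteProd δ (pastIndex l k)) ∂wienerMeasure N δ
      else 0 := by
  rw [pastSigma_eq] at hY
  have hpast : Measurable[coordSigma {i | i < l}] fun x =>
      Y x * MvPolynomial.eval x (hermiteProd δ (pastIndex l k)) :=
    hY.mul (measurable_eval_of_mem_supported
      (hermiteProd_mem_supported δ fun i hi => if_neg hi))
  have hfut : Measurable[coordSigma {i | ¬ i < l}] fun x =>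
      MvPolynomial.eval x (hermiteProd δ (futureIndex l k)) *
        MvPolynomial.eval x (hermiteProd δ (Pi.single l 1)) := by
    refine (measurable_eval_of_mem_supported (hermiteProd_mem_supported δ fun i hi => ?_)).mul
      (measurable_eval_of_mem_supported (hermiteProd_mem_supported δ fun i hi => ?_))
    · exact if_pos (not_not.1 hi)
    · exact Pi.single_eq_of_ne (ne_of_lt (not_not.1 hi)) _
  have h := (indepFun_of_coordSigma δ (disjoint_past_future l) hpast
    hfut).integral_fun_mul_eq_mul_integral
      (hpast.mono (coordSigma_le _) le_rfl).aestronglyMeasurable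
      (hfut.mono (coordSigma_le _) le_rfl).aestronglyMeasurable
  rw [integral_hermiteProd_mul_hermiteProd hδ] at h
  have hx : ∀ x : Fin N → ℝ, Y x * x l * MvPolynomial.eval x (hermiteProd δ k) =
      Real.sqrt δ * ((Y x * MvPolynomial.eval x (hermiteProd δ (pastIndex l k))) *
        (MvPolynomial.eval x (hermiteProd δ (futureIndex l k)) *
          MvPolynomial.eval x (hermiteProd δ (Pi.single l 1)))) := by
    intro x
    rw [eval_hermiteProd_eq_mul δ l k, eval_hermiteProd_single hδ l x]
    ring
  simp_rw [hx]
  rw [integral_const_mul, h]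
  split_ifs <;> simp

theorem update_pastIndex {l : Fin N} {k : Fin N → ℕ} (h : futureIndex l k = Pi.single l 1) :
    Function.update (pastIndex l k) l 1 = k := by
  ext i
  have hi := congrFun h i
  by_cases hil : i = l
  · subst hil
    simpa [futureIndex] using hi.symm
  · rw [Function.update_of_ne hil]
    by_cases hlt : i < l
    · simp [pastIndex, hlt]
    · simpa [pastIndex, futureIndex, hlt, hil] using hi.symm

/-- The factor `√δ` from `ΔW_l` cancels the `δ^{-1/2}` from `∂_l`, so each martingale term is a pure
projection of the chaos expansion. -/
theorem IsCondExpPast.integral_mul_coord {δ : ℝ≥0} (hδ : 0 < δ) {l : Fin N} {X : GenFunctional N}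
    {Y : (Fin N → ℝ) → ℝ} (hY : IsCondExpPast δ (partialDeriv δ l X) l Y) (k : Fin N → ℕ) :
    ∫ x, Y x * x l * MvPolynomial.eval x (hermiteProd δ k) ∂wienerMeasure N δ =
      if futureIndex l k = Pi.single l 1 then X (hermiteProd δ k) else 0 := by
  rw [integral_mul_coord_mul_hermiteProd hδ hY.1]
  split_ifs with h
  · have hs : Real.sqrt (δ : ℝ) ≠ 0 := (Real.sqrt_pos.2 hδ).ne'
    rw [← hY.2.2 (hermiteProd δ (pastIndex l k))
      (hermiteProd_mem_supported δ fun i hi => if_neg hi), partialDeriv_hermiteProd]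
    have h0 : pastIndex l k l = 0 := by simp [pastIndex]
    simp only [h0, zero_add, update_pastIndex h, Nat.cast_zero, Real.sqrt_one, one_mul]
    rw [← mul_assoc, mul_inv_cancel₀ hs, one_mul]
  · rfl

/-- The multi-indices that contribute to the first order error: those whose last nonzero entry
exceeds `1`. -/
def IsErrIndex (k : Fin N → ℕ) : Prop := k ≠ 0 ∧ ∀ l, futureIndex l k ≠ Pi.single l 1

/-- If `l < m`, the first hypothesis gives `k m = 0` and the second `k m = 1`. -/
theorem futureIndex_eq_single_unique {k : Fin N → ℕ} {l m : Fin N}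
    (hl : futureIndex l k = Pi.single l 1) (hm : futureIndex m k = Pi.single m 1) : l = m := by
  wlog h : l < m generalizing l m
  · by_contra hne
    exact hne (this hm hl (lt_of_le_of_ne (not_lt.1 h) (Ne.symm hne))).symm
  have h1 := congrFun hl m
  have h2 := congrFun hm m
  simp [futureIndex, h.not_gt, h.ne'] at h1 h2
  omega

open Classical in
-- The case `k = 0` and the cases for the various `l` exclude one another, so `a` is subtracted at
-- most once.
theorem sum_futureIndex (k : Fin N → ℕ) (a : ℝ) :
    a - (if k = 0 then a else 0) - ∑ l, (if futureIndex l k = Pi.single l 1 then a else 0) =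
      if IsErrIndex k then a else 0 := by
  by_cases h : ∃ l, futureIndex l k = Pi.single l 1
  · obtain ⟨l, hl⟩ := h
    rw [Finset.sum_eq_single l]
    · have hk : k ≠ 0 := by
        rintro rfl
        simpa [futureIndex] using congrFun hl l
      have hE : ¬ IsErrIndex k := fun h => h.2 l hl
      simp [hl, hk, hE]
    · intro m _ hm
      rw [if_neg fun h => hm (futureIndex_eq_single_unique h hl)]
    · simp
  · push Not at h
    simp only [h, if_false, Finset.sum_const_zero, sub_zero, IsErrIndex]
    by_cases hk : k = 0 <;> simp [hk, h]

theorem IsFirstMartErr.memLp {δ : ℝ≥0} {X : GenFunctional N} {e : (Fin N → ℝ) → ℝ}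
    (he : IsFirstMartErr δ X e) : MemLp e 2 (wienerMeasure N δ) := by
  obtain ⟨f, Y, hf, hY, hfe⟩ := he
  refine MemLp.ae_eq hfe.symm ((hf.1.sub (memLp_const _)).sub ?_)
  exact memLp_finsetSum _ fun l _ => memLp_mul_coord (hY l).1 (hY l).2.1

open Classical in
theorem IsFirstMartErr.integral_mul_hermiteProd {δ : ℝ≥0} (hδ : 0 < δ) {X : GenFunctional N}
    {e : (Fin N → ℝ) → ℝ} (he : IsFirstMartErr δ X e) (k : Fin N → ℕ) :
    ∫ x, e x * MvPolynomial.eval x (hermiteProd δ k) ∂wienerMeasure N δ =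
      if IsErrIndex k then X (hermiteProd δ k) else 0 := by
  obtain ⟨f, Y, hf, hY, hfe⟩ := he
  have hH := memLp_eval δ (hermiteProd δ k)
  have hfi : Integrable (fun x => f x * MvPolynomial.eval x (hermiteProd δ k))
      (wienerMeasure N δ) := hf.1.integrable_mul hH
  have hei : Integrable (fun x => expect X * MvPolynomial.eval x (hermiteProd δ k))
      (wienerMeasure N δ) := (hH.integrable one_le_two).const_mul _
  have hYi : ∀ l, Integrable (fun x => Y l x * x l * MvPolynomial.eval x (hermiteProd δ k))
      (wienerMeasure N δ) := fun l =>
    (memLp_mul_coord (hY l).1 (hY l).2.1).integrable_mul hH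
  have h1 : ∫ x, expect X * MvPolynomial.eval x (hermiteProd δ k) ∂wienerMeasure N δ =
      if k = 0 then X (hermiteProd δ k) else 0 := by
    have := integral_hermiteProd_mul_hermiteProd hδ (0 : Fin N → ℕ) k
    rw [hermiteProd_zero] at this
    simp only [map_one, one_mul] at this
    rw [integral_const_mul, this, expect]
    by_cases h : k = 0
    · simp [h, hermiteProd_zero]
    · simp [h, Ne.symm h]
  calc ∫ x, e x * MvPolynomial.eval x (hermiteProd δ k) ∂wienerMeasure N δ
      = ∫ x, (f x * MvPolynomial.eval x (hermiteProd δ k) -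
          expect X * MvPolynomial.eval x (hermiteProd δ k) -
          ∑ l, Y l x * x l * MvPolynomial.eval x (hermiteProd δ k)) ∂wienerMeasure N δ := by
        refine integral_congr_ae ?_
        filter_upwards [hfe] with x hx
        rw [hx, sub_mul, sub_mul, Finset.sum_mul]
    _ = X (hermiteProd δ k) - (if k = 0 then X (hermiteProd δ k) else 0) -
          ∑ l, (if futureIndex l k = Pi.single l 1 then X (hermiteProd δ k) else 0) := by
        refine (integral_sub (hfi.sub hei) (integrable_finsetSum _ fun l _ => hYi l)).trans ?_
        rw [integral_sub' hfi hei, integral_finsetSum _ fun l _ => hYi l, h1, ← hf.2]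
        simp_rw [(hY _).integral_mul_coord hδ k]
    _ = _ := sum_futureIndex k _

open Classical in
theorem IsFirstMartErr.hasSum {δ : ℝ≥0} (hδ : 0 < δ) {X : GenFunctional N}
    {e : (Fin N → ℝ) → ℝ} (he : IsFirstMartErr δ X e) :
    HasSum (fun k => if IsErrIndex k then X (hermiteProd δ k) ^ 2 else 0)
      (∫ x, e x ^ 2 ∂wienerMeasure N δ) := by
  have h := hasSum_sq_integral_hermiteProd hδ he.memLp
  simp_rw [he.integral_mul_hermiteProd hδ, ite_pow, zero_pow two_ne_zero] at h
  exact h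

/-! ### Existence of the error -/

theorem exists_isRepresentedBy {δ : ℝ≥0} (hδ : 0 < δ) {X : GenFunctional N}
    (hX : Summable fun k => X (hermiteProd δ k) ^ 2) : ∃ f, IsRepresentedBy δ X f := by
  obtain ⟨f, hf, hfk⟩ := exists_memLp_of_summable hδ hX
  exact ⟨f, hf, fun P =>
    integral_mul_eval_eq hδ hf Set.univ X (fun k _ => (hfk k).symm) (by simp)⟩

/-- `∂_l X` need not be square integrable, because raising `k l` costs `√(k l + 1)`. Polynomials of
the past only see indices with `k l = 0`, where this cost is `1`; that part of `∂_l X` is a function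
`g ∈ L²`, which can be conditioned as usual. -/
theorem exists_isCondExpPast {δ : ℝ≥0} (hδ : 0 < δ) {X : GenFunctional N}
    (hX : Summable fun k => X (hermiteProd δ k) ^ 2) (l : Fin N) :
    ∃ Y, IsCondExpPast δ (partialDeriv δ l X) l Y := by
  classical
  let c : (Fin N → ℕ) → ℝ := fun k =>
    if k l = 0 then partialDeriv δ l X (hermiteProd δ k) else 0
  have hinj : Function.Injective fun k : Fin N → ℕ => Function.update k l (k l + 1) := by
    intro j k hjk
    ext i
    have hi := congrFun hjk i
    by_cases h : i = l
    · subst h; simpa using hi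
    · simpa [Function.update_of_ne h] using hi
  have hc : Summable fun k => c k ^ 2 := by
    refine Summable.of_nonneg_of_le (fun k => sq_nonneg _) (fun k => ?_)
      ((hX.comp_injective hinj).mul_left ((δ : ℝ)⁻¹))
    by_cases hk : k l = 0
    · simp only [c, hk, if_true, partialDeriv_hermiteProd, Function.comp_apply]
      rw [inv_eq_inv_sqrt_mul]
      apply le_of_eq
      simp
      ring
    · simp only [c, hk, if_false, Function.comp_apply, zero_pow two_ne_zero]
      exact mul_nonneg (inv_nonneg.2 δ.coe_nonneg) (sq_nonneg _)
  obtain ⟨g, hg, hgk⟩ := exists_memLp_of_summable hδ hc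
  have hm : pastSigma l ≤ MeasurableSpace.pi := pastSigma_eq l ▸ coordSigma_le _
  refine ⟨(wienerMeasure N δ)[g | pastSigma l], stronglyMeasurable_condExp.measurable,
    hg.condExp one_le_two, fun P hP => ?_⟩
  have hPm : StronglyMeasurable[pastSigma l] fun x => MvPolynomial.eval x P := by
    rw [pastSigma_eq]
    exact (measurable_eval_of_mem_supported hP).stronglyMeasurable
  have hgP : Integrable (g * fun x => MvPolynomial.eval x P) (wienerMeasure N δ) :=
    hg.integrable_mul (memLp_eval δ P)
  rw [integral_mul_eval_eq hδ hg {i | i < l} _ (fun k hk => ?_) hP]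
  · calc ∫ x, g x * MvPolynomial.eval x P ∂wienerMeasure N δ
        = ∫ x, ((wienerMeasure N δ)[g * fun x => MvPolynomial.eval x P | pastSigma l]) x
            ∂wienerMeasure N δ := (integral_condExp hm).symm
      _ = _ := integral_congr_ae
          (condExp_mul_of_stronglyMeasurable_right hPm hgP (hg.integrable one_le_two))
  · rw [hgk]
    exact (if_pos (hk l (by simp))).symm

theorem exists_isFirstMartErr {δ : ℝ≥0} (hδ : 0 < δ) {X : GenFunctional N}
    (hX : Summable fun k => X (hermiteProd δ k) ^ 2) : ∃ e, IsFirstMartErr δ X e := by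
  obtain ⟨f, hf⟩ := exists_isRepresentedBy hδ hX
  choose Y hY using exists_isCondExpPast hδ hX
  exact ⟨_, f, Y, hf, hY, Filter.EventuallyEq.rfl⟩

/-! ### Counting the error indices -/

/-- The multinomial weight `n! / ∏ k_i!`. -/
def multWeight (n : ℕ) (k : Fin N → ℕ) : ℝ := (n.factorial : ℝ) / ∏ i, ((k i).factorial : ℝ)

theorem multWeight_nonneg (n : ℕ) (k : Fin N → ℕ) : 0 ≤ multWeight n k := by
  unfold multWeight
  positivity

/-- The multinomial theorem with all variables equal to `1`; entries outside `s` vanish and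
contribute `0! = 1`. -/
theorem sum_multWeight (s : Finset (Fin N)) (n : ℕ) :
    ∑ k ∈ Finset.piAntidiag s n, multWeight n k = (s.card : ℝ) ^ n := by
  have h := Finset.sum_pow_eq_sum_piAntidiag s (fun _ : Fin N => (1 : ℝ)) n
  simp only [Finset.sum_const, nsmul_eq_mul, mul_one, one_pow, Finset.prod_const_one] at h
  rw [h]
  refine Finset.sum_congr rfl fun k hk => ?_
  rw [Finset.mem_piAntidiag] at hk
  have hspec := Nat.multinomial_spec s k
  rw [hk.1] at hspec
  have hprod : ∏ i, ((k i).factorial : ℝ) = ∏ i ∈ s, ((k i).factorial : ℝ) := by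
    refine (Finset.prod_subset (Finset.subset_univ s) fun i _ hi => ?_).symm
    have : k i = 0 := by
      by_contra h0
      exact hi (hk.2 i h0)
    simp [this]
  rw [multWeight, hprod, div_eq_iff (by positivity), ← hspec]
  push_cast
  ring

theorem multWeight_update_one {l : Fin N} {m : ℕ} {k : Fin N → ℕ} (hk : k l = 0) :
    multWeight (m + 1) (Function.update k l 1) = (m + 1) * multWeight m k := by
  have : ∏ i, ((Function.update k l 1 i).factorial : ℝ) = ∏ i, ((k i).factorial : ℝ) := by
    refine Finset.prod_congr rfl fun i _ => ?_
    by_cases h : i = l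
    · subst h; simp [hk]
    · rw [Function.update_of_ne h]
  rw [multWeight, multWeight, this, Nat.factorial_succ]
  push_cast
  ring

/-- The weights on `Iic l` total `(l + 1)^(m+1)`, as `l` counts from `0`. Indices with `k l = 0`
(the set `B`) account for `l^(m+1)`, and those with `k l = 1` (the set `D`) for `(m + 1) l^m`. -/
theorem sum_multWeight_two_le (l : Fin N) (m : ℕ) :
    ∑ k ∈ (Finset.piAntidiag (Finset.Iic l) (m + 1)).filter (fun k => 2 ≤ k l),
      multWeight (m + 1) k ≤
        ((l : ℝ) + 1) ^ (m + 1) - (l : ℝ) ^ (m + 1) - (m + 1) * (l : ℝ) ^ m := by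
  classical
  set A := (Finset.piAntidiag (Finset.Iic l) (m + 1)).filter (fun k => 2 ≤ k l)
  set B := Finset.piAntidiag (Finset.Iio l) (m + 1)
  set D := (Finset.piAntidiag (Finset.Iio l) m).image fun k => Function.update k l 1
  have hzero : ∀ {n : ℕ} {k : Fin N → ℕ}, k ∈ Finset.piAntidiag (Finset.Iio l) n → k l = 0 := by
    intro n k hk
    rw [Finset.mem_piAntidiag] at hk
    by_contra h
    simpa using hk.2 l h
  have hD : ∀ k ∈ D, k l = 1 := by
    intro k hk
    obtain ⟨j, _, rfl⟩ := Finset.mem_image.1 hk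
    simp
  have hB : ∀ k ∈ B, k l = 0 := fun k hk => hzero hk
  have hA : ∀ k ∈ A, 2 ≤ k l := fun k hk => (Finset.mem_filter.1 hk).2
  have hAB : Disjoint A B := Finset.disjoint_left.2 fun k h1 h2 => by
    have := hA k h1; have := hB k h2; omega
  have hABD : Disjoint (A ∪ B) D := Finset.disjoint_left.2 fun k h1 h2 => by
    have h3 := hD k h2
    rcases Finset.mem_union.1 h1 with h | h
    · have := hA k h; omega
    · have := hB k h; omega
  have hIic : Finset.Iic l = insert l (Finset.Iio l) := by
    ext i; simp [le_iff_eq_or_lt]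
  have hsub : A ∪ B ∪ D ⊆ Finset.piAntidiag (Finset.Iic l) (m + 1) := by
    refine Finset.union_subset (Finset.union_subset (Finset.filter_subset _ _) ?_) ?_
    · intro k hk
      have h0 := hB k hk
      rw [Finset.mem_piAntidiag] at hk ⊢
      refine ⟨?_, fun i hi => Finset.mem_Iic.2 (Finset.mem_Iio.1 (hk.2 i hi)).le⟩
      rw [hIic, Finset.sum_insert (by simp), h0, zero_add, hk.1]
    · intro k hk
      obtain ⟨j, hj, rfl⟩ := Finset.mem_image.1 hk
      rw [Finset.mem_piAntidiag] at hj ⊢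
      refine ⟨?_, fun i hi => ?_⟩
      · rw [hIic, Finset.sum_insert (by simp), Function.update_self, add_comm, ← hj.1]
        congr 1
        refine Finset.sum_congr rfl fun i hi => ?_
        rw [Function.update_of_ne (Finset.mem_Iio.1 hi).ne]
      · by_cases h : i = l
        · simp [h]
        · rw [Function.update_of_ne h] at hi
          exact Finset.mem_Iic.2 (Finset.mem_Iio.1 (hj.2 i hi)).le
  have hsum := Finset.sum_le_sum_of_subset_of_nonneg hsub
    fun k _ _ => multWeight_nonneg (m + 1) k
  have hDsum : ∑ k ∈ D, multWeight (m + 1) k = (m + 1) * (l : ℝ) ^ m := by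
    rw [Finset.sum_image]
    · rw [Finset.sum_congr rfl fun k hk => multWeight_update_one (hzero hk), ← Finset.mul_sum,
        sum_multWeight]
      simp
    · intro j hj k hk hjk
      ext i
      have hi := congrFun hjk i
      by_cases h : i = l
      · subst h; rw [hzero hj, hzero hk]
      · simpa [Function.update_of_ne h] using hi
  rw [Finset.sum_union hABD, Finset.sum_union hAB, hDsum, sum_multWeight, sum_multWeight] at hsum
  simp only [Fin.card_Iio, Fin.card_Iic, Nat.cast_add, Nat.cast_one] at hsum
  linarith

/-- Take `l` the last nonzero position: were `k l = 1`, the part of `k` from `l` on would be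
`Pi.single l 1`. -/
theorem IsErrIndex.exists_two_le {k : Fin N → ℕ} (hk : IsErrIndex k) :
    ∃ l, 2 ≤ k l ∧ ∀ i, k i ≠ 0 → i ≤ l := by
  obtain ⟨j, hj⟩ := Function.ne_iff.1 hk.1
  have hne : (Finset.univ.filter fun i => k i ≠ 0).Nonempty := ⟨j, by simpa using hj⟩
  set l := (Finset.univ.filter fun i => k i ≠ 0).max' hne with hl
  have hmem : k l ≠ 0 := (Finset.mem_filter.1 (Finset.max'_mem _ hne)).2
  have hmax : ∀ i, k i ≠ 0 → i ≤ l := fun i hi => Finset.le_max' _ _ (by simpa using hi)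
  refine ⟨l, ?_, hmax⟩
  by_contra h
  have h1 : k l = 1 := by omega
  refine hk.2 l (funext fun i => ?_)
  by_cases hil : i = l
  · rw [hil]; simp [futureIndex, h1]
  · rw [Pi.single_eq_of_ne hil, futureIndex]
    split_ifs with h2
    · rfl
    · by_contra h3
      exact hil (le_antisymm (hmax i h3) (not_lt.1 h2))

/-- Mean value bound that turns the count for fixed `l` into a telescoping difference. -/
theorem add_one_pow_sub_pow_le (x : ℝ) (hx : 0 ≤ x) (m : ℕ) :
    (x + 1) ^ (m + 1) - x ^ (m + 1) ≤ (m + 1) * (x + 1) ^ m := by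
  induction m with
  | zero => simp
  | succ m ih =>
    have h1 : x ^ (m + 1) ≤ (x + 1) ^ (m + 1) := by gcongr; linarith
    have h2 : (x + 1) ^ (m + 2) - x ^ (m + 2) =
        x * ((x + 1) ^ (m + 1) - x ^ (m + 1)) + (x + 1) ^ (m + 1) := by ring
    have h3 : x * ((x + 1) ^ (m + 1) - x ^ (m + 1)) ≤ x * ((m + 1) * (x + 1) ^ m) := by gcongr
    have h4 : (0 : ℝ) ≤ (m + 1) * (x + 1) ^ m := by positivity
    push_cast
    rw [h2]
    have h5 : ((m : ℝ) + 1 + 1) * (x + 1) ^ (m + 1) =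
      x * ((m + 1) * (x + 1) ^ m) + (m + 1) * (x + 1) ^ m + (x + 1) ^ (m + 1) := by ring
    linarith

open Classical in
theorem sum_multWeight_isErrIndex_le (N m : ℕ) :
    ∑ k ∈ (Finset.piAntidiag (Finset.univ : Finset (Fin N)) (m + 1)).filter IsErrIndex,
      multWeight (m + 1) k ≤ (m + 1) * (N : ℝ) ^ m := by
  have hsub : (Finset.piAntidiag (Finset.univ : Finset (Fin N)) (m + 1)).filter IsErrIndex ⊆
      Finset.univ.biUnion fun l : Fin N =>
        (Finset.piAntidiag (Finset.Iic l) (m + 1)).filter (fun k => 2 ≤ k l) := by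
    intro k hk
    rw [Finset.mem_filter, Finset.mem_piAntidiag] at hk
    obtain ⟨l, h2, hl⟩ := hk.2.exists_two_le
    rw [Finset.mem_biUnion]
    refine ⟨l, Finset.mem_univ l, Finset.mem_filter.2 ⟨?_, h2⟩⟩
    rw [Finset.mem_piAntidiag]
    refine ⟨?_, fun i hi => Finset.mem_Iic.2 (hl i hi)⟩
    rw [← hk.1.1]
    refine Finset.sum_subset (Finset.subset_univ _) fun i _ hi => ?_
    by_contra h
    exact hi (Finset.mem_Iic.2 (hl i h))
  calc _ ≤ ∑ k ∈ Finset.univ.biUnion fun l : Fin N =>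
        (Finset.piAntidiag (Finset.Iic l) (m + 1)).filter (fun k => 2 ≤ k l),
          multWeight (m + 1) k :=
        Finset.sum_le_sum_of_subset_of_nonneg hsub fun k _ _ => multWeight_nonneg _ k
    _ ≤ ∑ l : Fin N, ∑ k ∈ (Finset.piAntidiag (Finset.Iic l) (m + 1)).filter (fun k => 2 ≤ k l),
          multWeight (m + 1) k := by
        -- The last nonzero position is unique, so the sets for different `l` are disjoint.
        refine (Finset.sum_biUnion fun l _ j _ hlj => ?_).le
        have key : ∀ {l j : Fin N} {k : Fin N → ℕ}, l < j → 2 ≤ k j →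
            k ∉ Finset.piAntidiag (Finset.Iic l) (m + 1) := by
          intro l j k h hj hk
          have := Finset.mem_Iic.1 ((Finset.mem_piAntidiag.1 hk).2 j (by omega))
          exact absurd h (not_lt.2 this)
        refine Finset.disjoint_left.2 fun k h1 h2 => ?_
        rw [Finset.mem_filter] at h1 h2
        rcases lt_or_gt_of_ne hlj with h | h
        · exact key h h2.2 h1.1
        · exact key h h1.2 h2.1
    _ ≤ ∑ l : Fin N, ((m + 1) * ((l : ℝ) + 1) ^ m - (m + 1) * (l : ℝ) ^ m) := by
        refine Finset.sum_le_sum fun l _ => (sum_multWeight_two_le l m).trans ?_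
        have := add_one_pow_sub_pow_le (l : ℝ) (Nat.cast_nonneg _) m
        linarith
    _ = (m + 1) * (N : ℝ) ^ m - (m + 1) * (0 : ℝ) ^ m := by
        rw [Fin.sum_univ_eq_sum_range (fun l : ℕ =>
          ((m : ℝ) + 1) * ((l : ℝ) + 1) ^ m - (m + 1) * (l : ℝ) ^ m)]
        have := Finset.sum_range_sub (fun l : ℕ => ((m : ℝ) + 1) * (l : ℝ) ^ m) N
        simpa using this
    _ ≤ _ := by
        have : (0 : ℝ) ≤ (m + 1) * (0 : ℝ) ^ m := by positivity
        linarith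

/-! ### The error bound -/

theorem tsum_eq_tsum_piAntidiag (g : (Fin N → ℕ) → ℝ≥0∞) :
    ∑' k, g k = ∑' n, ∑ k ∈ Finset.piAntidiag (Finset.univ : Finset (Fin N)) n, g k := by
  rw [← ENNReal.tsum_fiberwise g fun k => ∑ i, k i]
  refine tsum_congr fun n => ?_
  have : (fun k : Fin N → ℕ => ∑ i, k i) ⁻¹' {n} =
      (Finset.piAntidiag (Finset.univ : Finset (Fin N)) n : Set (Fin N → ℕ)) := by
    ext k
    simp
  rw [this]
  exact Finset.tsum_subtype _ g

theorem chaosNormSq_nonneg (δ : ℝ≥0) (n : ℕ) (X : GenFunctional N) : 0 ≤ chaosNormSq δ n X :=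
  integral_nonneg fun _ => sq_nonneg _

theorem summable_sq_of_sobolevNormSq_ne_top {δ : ℝ≥0} (hδ : 0 < δ) {s : ℝ} (hs : 0 ≤ s)
    {X : GenFunctional N} (hX : sobolevNormSq δ s X ≠ ∞) :
    Summable fun k => X (hermiteProd δ k) ^ 2 := by
  have h : ∑' k, ENNReal.ofReal (X (hermiteProd δ k) ^ 2) ≠ ∞ := by
    refine ne_top_of_le_ne_top hX ?_
    rw [tsum_eq_tsum_piAntidiag]
    refine ENNReal.tsum_le_tsum fun n => ?_
    rw [← ENNReal.ofReal_sum_of_nonneg fun _ _ => sq_nonneg _, ← chaosNormSq_eq hδ]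
    refine ENNReal.ofReal_le_ofReal (le_mul_of_one_le_left (chaosNormSq_nonneg _ _ _) ?_)
    exact Real.one_le_rpow (by simp) hs
  simpa [ENNReal.toReal_ofReal, sq_nonneg] using ENNReal.summable_toReal h

open Classical in
/-- The contribution of the `n`-th chaos to the squared norm of the first order error. -/
def errChaosNormSq (δ : ℝ≥0) (n : ℕ) (X : GenFunctional N) : ℝ :=
  ∑ k ∈ (Finset.piAntidiag (Finset.univ : Finset (Fin N)) n).filter IsErrIndex,
    X (hermiteProd δ k) ^ 2

theorem errChaosNormSq_le_chaosNormSq {δ : ℝ≥0} (hδ : 0 < δ) (n : ℕ) (X : GenFunctional N) :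
    errChaosNormSq δ n X ≤ chaosNormSq δ n X := by
  classical
  rw [chaosNormSq_eq hδ]
  exact Finset.sum_le_sum_of_subset_of_nonneg (Finset.filter_subset _ _) fun _ _ _ => sq_nonneg _

/-- An entry at least `2` forces degree at least `2`; this covers the degrees where the
finite-dimensional property says nothing. -/
theorem errChaosNormSq_of_lt_two (δ : ℝ≥0) {n : ℕ} (hn : n < 2) (X : GenFunctional N) :
    errChaosNormSq δ n X = 0 := by
  classical
  rw [errChaosNormSq, Finset.filter_false_of_mem, Finset.sum_empty]
  intro k hk hE
  obtain ⟨l, hl, _⟩ := hE.exists_two_le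
  have h1 := Finset.single_le_sum (f := k) (fun i _ => Nat.zero_le _) (Finset.mem_univ l)
  rw [(Finset.mem_piAntidiag.1 hk).1] at h1
  omega

/-- Passes from a bound in each chaos to the full norm. It is used with `B` of order `N^{-s}` for
large `N` and with `B = 1` for small `N`. -/
theorem IsFirstMartErr.integral_sq_le {δ : ℝ≥0} (hδ : 0 < δ) {X : GenFunctional N}
    {e : (Fin N → ℝ) → ℝ} (he : IsFirstMartErr δ X e) {s B : ℝ} (hB : 0 ≤ B) {M : ℝ≥0}
    (hM : sobolevNormSq δ s X ≤ M)
    (h : ∀ n : ℕ, errChaosNormSq δ n X ≤ B * ((1 + (n : ℝ)) ^ s * chaosNormSq δ n X)) :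
    ∫ x, e x ^ 2 ∂wienerMeasure N δ ≤ B * M := by
  classical
  have hsum := he.hasSum hδ
  have h0 : ∀ k : Fin N → ℕ, 0 ≤ if IsErrIndex k then X (hermiteProd δ k) ^ 2 else 0 := by
    intro k
    split_ifs <;> positivity
  rw [← ENNReal.ofReal_le_ofReal_iff (by positivity)]
  calc ENNReal.ofReal (∫ x, e x ^ 2 ∂wienerMeasure N δ)
      = ∑' n, ENNReal.ofReal (errChaosNormSq δ n X) := by
        rw [← hsum.tsum_eq, ENNReal.ofReal_tsum_of_nonneg h0 hsum.summable,
          tsum_eq_tsum_piAntidiag]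
        refine tsum_congr fun n => ?_
        rw [← ENNReal.ofReal_sum_of_nonneg fun k _ => h0 k, errChaosNormSq, Finset.sum_filter]
    _ ≤ ∑' n : ℕ, ENNReal.ofReal B * ENNReal.ofReal ((1 + (n : ℝ)) ^ s * chaosNormSq δ n X) := by
        refine ENNReal.tsum_le_tsum fun n => ?_
        rw [← ENNReal.ofReal_mul hB]
        exact ENNReal.ofReal_le_ofReal (h n)
    _ = ENNReal.ofReal B * sobolevNormSq δ s X := ENNReal.tsum_mul_left
    _ ≤ ENNReal.ofReal B * M := by gcongr
    _ = ENNReal.ofReal (B * M) := by rw [ENNReal.ofReal_mul hB, ENNReal.ofReal_coe_nnreal]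

theorem errChaosNormSq_le_of_finiteDimensional {N : ℕ} (hN : 0 < N) {T : ℝ≥0} (hT : 0 < T)
    {X : GenFunctional N} {C : ℝ} (hC : 0 ≤ C) (m : ℕ)
    (h : ∀ k : Fin N → ℕ, ∑ i, k i = m + 1 → expect (mixedDeriv (T / N) k X) ^ 2 ≤
      C * (((m + 1).factorial : ℝ) * chaosNormSq (T / N) (m + 1) X / (T : ℝ) ^ (m + 1))) :
    errChaosNormSq (T / N) (m + 1) X ≤
      C * (((m : ℝ) + 1) / N) * chaosNormSq (T / N) (m + 1) X := by
  classical
  have hN' : (0 : ℝ) < N := by exact_mod_cast hN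
  have hT' : (0 : ℝ) < T := by exact_mod_cast hT
  set c := chaosNormSq (T / N) (m + 1) X with hc
  have hc0 : 0 ≤ c := chaosNormSq_nonneg _ _ _
  -- Dividing the hypothesis by `(∏ k_i!) δ^{-(m+1)}` with `δ = T / N` cancels the powers of `T`.
  have hk : ∀ k : Fin N → ℕ, ∑ i, k i = m + 1 →
      X (hermiteProd (T / N) k) ^ 2 ≤ C * c / (N : ℝ) ^ (m + 1) * multWeight (m + 1) k := by
    intro k hk
    have h1 := h k hk
    rw [sq_expect_mixedDeriv, hk] at h1
    have hp : (0 : ℝ) < ∏ i, ((k i).factorial : ℝ) := by positivity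
    have hq : (0 : ℝ) < (∏ i, ((k i).factorial : ℝ)) * (N / T : ℝ) ^ (m + 1) := by positivity
    have h2 : (((T / N : ℝ≥0) : ℝ))⁻¹ = (N / T : ℝ) := by push_cast; rw [inv_div]
    rw [h2] at h1
    rw [← mul_le_mul_iff_right₀ hq]
    refine h1.trans (le_of_eq ?_)
    rw [multWeight, div_pow]
    field_simp
  calc errChaosNormSq (T / N) (m + 1) X
      ≤ ∑ k ∈ (Finset.piAntidiag (Finset.univ : Finset (Fin N)) (m + 1)).filter IsErrIndex,
          C * c / (N : ℝ) ^ (m + 1) * multWeight (m + 1) k := by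
        refine Finset.sum_le_sum fun k hk' => hk k ?_
        exact (Finset.mem_piAntidiag.1 (Finset.mem_filter.1 hk').1).1
    _ ≤ C * c / (N : ℝ) ^ (m + 1) * ((m + 1) * (N : ℝ) ^ m) := by
        rw [← Finset.mul_sum]
        gcongr
        exact sum_multWeight_isErrIndex_le N m
    _ = _ := by
        rw [pow_succ]
        field_simp

/-- Interpolation: for `y ≥ 1` the trivial bound suffices since `1 ≤ y^s`; for `y ≤ 1` one has `y ≤
y^s`. -/
theorem le_mul_rpow_of_le_of_le {a c C y s : ℝ} (hc : 0 ≤ c) (hy : 0 ≤ y) (hs0 : 0 ≤ s)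
    (hs1 : s ≤ 1) (h1 : a ≤ c) (h2 : a ≤ C * y * c) : a ≤ max C 1 * y ^ s * c := by
  have hC : (0 : ℝ) ≤ max C 1 := zero_le_one.trans (le_max_right _ _)
  rcases le_total 1 y with h | h
  · calc a ≤ 1 * 1 * c := by simpa using h1
      _ ≤ max C 1 * y ^ s * c := by
        gcongr
        · exact le_max_right _ _
        · exact Real.one_le_rpow h hs0
  · calc a ≤ C * y * c := h2
      _ ≤ max C 1 * y ^ s * c := by
        gcongr
        · exact le_max_left _ _
        · exact Real.self_le_rpow_of_le_one hy h hs1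

theorem errChaosNormSq_le_rpow {N : ℕ} (hN : 0 < N) {T : ℝ≥0} (hT : 0 < T) {s : ℝ} (hs0 : 0 ≤ s)
    (hs1 : s ≤ 1) {X : GenFunctional N} {C : ℝ} (hC : 0 ≤ C)
    (h : ∀ n : ℕ, 2 ≤ n → ∀ k : Fin N → ℕ, ∑ i, k i = n → expect (mixedDeriv (T / N) k X) ^ 2 ≤
      C * ((n.factorial : ℝ) * chaosNormSq (T / N) n X / (T : ℝ) ^ n)) (n : ℕ) :
    errChaosNormSq (T / N) n X ≤
      max C 1 * (N : ℝ) ^ (-s) * ((1 + (n : ℝ)) ^ s * chaosNormSq (T / N) n X) := by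
  have hN' : (0 : ℝ) < N := by exact_mod_cast hN
  have hδ : 0 < T / (N : ℝ≥0) := div_pos hT (by exact_mod_cast hN)
  have hc := chaosNormSq_nonneg (T / N) n X
  rcases lt_or_ge n 2 with hn | hn
  · rw [errChaosNormSq_of_lt_two _ hn]
    have : (0 : ℝ) ≤ max C 1 := zero_le_one.trans (le_max_right _ _)
    positivity
  · obtain ⟨m, rfl⟩ : ∃ m, n = m + 1 := ⟨n - 1, by omega⟩
    have h2 := errChaosNormSq_le_of_finiteDimensional hN hT hC m (h (m + 1) hn)
    -- The numerator `n = m + 1` is enlarged to `1 + n` to match the Sobolev weight.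
    have h3 : errChaosNormSq (T / N) (m + 1) X ≤
        C * ((1 + ((m + 1 : ℕ) : ℝ)) / N) * chaosNormSq (T / N) (m + 1) X := by
      have hle : (m : ℝ) + 1 ≤ 1 + ((m + 1 : ℕ) : ℝ) := by
        push_cast
        linarith
      exact h2.trans (by gcongr)
    refine (le_mul_rpow_of_le_of_le hc (by positivity) hs0 hs1
      (errChaosNormSq_le_chaosNormSq hδ _ _) h3).trans (le_of_eq ?_)
    rw [Real.div_rpow (by positivity) hN'.le, Real.rpow_neg hN'.le]
    ring

end

end DiscreteWiener

/-! ### Assembly of the bound for large and small `N` -/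

open DiscreteWiener in
theorem theorem3p4 (T : ℝ≥0) (hT : 0 < T) (s : ℝ) (hs0 : 0 ≤ s) (hs1 : s ≤ 1)
    (F : (N : ℕ+) → DiscreteWiener.GenFunctional (N : ℕ))
    (hF : ∀ N : ℕ+, F N ∈ DiscreteWiener.sobolevSpaceNegInf (N : ℕ) (T / (N : ℕ)))
    (hbdd : ∃ M : ℝ≥0, ∀ N : ℕ+, DiscreteWiener.sobolevNormSq (T / (N : ℕ)) s (F N) ≤ M)
    (hfdp : DiscreteWiener.FiniteDimensionalProperty T F) :
    ∃ C : ℝ, ∀ N : ℕ+,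
      (∃ e, DiscreteWiener.IsFirstMartErr (T / (N : ℕ)) (F N) e) ∧
      ∀ e, DiscreteWiener.IsFirstMartErr (T / (N : ℕ)) (F N) e →
        MemLp e 2 (DiscreteWiener.wienerMeasure (N : ℕ) (T / (N : ℕ))) ∧
        ∫ x, e x ^ 2 ∂DiscreteWiener.wienerMeasure (N : ℕ) (T / (N : ℕ)) ≤
          C * (N : ℝ) ^ (-s) := by
  obtain ⟨M, hM⟩ := hbdd
  obtain ⟨C, hC⟩ := hfdp
  obtain ⟨N₀, hN₀⟩ := Filter.eventually_atTop.1 hC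
  have hA : (0 : ℝ) ≤ max (max C 0) 1 := zero_le_one.trans (le_max_right _ _)
  -- The first summand serves `N ≥ N₀`, with `max C 0` because `C` may be negative. The second
  -- serves `N ≤ N₀`, where `(N₀ / N)^s ≥ 1` and the error is bounded by the Sobolev norm itself.
  refine ⟨(max (max C 0) 1 + (N₀ : ℝ) ^ s) * M, fun N => ?_⟩
  have hN : (0 : ℝ) < (N : ℕ) := by exact_mod_cast N.pos
  have hδ : 0 < T / ((N : ℕ) : ℝ≥0) := div_pos hT (by exact_mod_cast N.pos)
  refine ⟨exists_isFirstMartErr hδ (summable_sq_of_sobolevNormSq_ne_top hδ hs0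
    (ne_top_of_le_ne_top ENNReal.coe_ne_top (hM N))), fun e he => ⟨he.memLp, ?_⟩⟩
  rcases le_total N₀ N with h | h
  · have hfd : ∀ n : ℕ, 2 ≤ n → ∀ k : Fin (N : ℕ) → ℕ, ∑ i, k i = n →
        expect (mixedDeriv (T / (N : ℕ)) k (F N)) ^ 2 ≤
          max C 0 * ((n.factorial : ℝ) * chaosNormSq (T / (N : ℕ)) n (F N) / (T : ℝ) ^ n) := by
      intro n hn k hk
      refine (hN₀ N h n hn k hk).trans ?_
      have := chaosNormSq_nonneg (T / (N : ℕ)) n (F N)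
      gcongr
      exact le_max_left _ _
    refine (he.integral_sq_le hδ (by positivity) (hM N)
      (errChaosNormSq_le_rpow N.pos hT hs0 hs1 (le_max_right _ _) hfd)).trans ?_
    rw [mul_right_comm]
    gcongr
    exact le_add_of_nonneg_right (by positivity)
  · have hle : ((N : ℕ) : ℝ) ≤ ((N₀ : ℕ) : ℝ) := by exact_mod_cast h
    have h1 : (1 : ℝ) ≤ ((N₀ : ℕ) : ℝ) ^ s * ((N : ℕ) : ℝ) ^ (-s) := by
      rw [Real.rpow_neg hN.le, ← div_eq_mul_inv, one_le_div (by positivity)]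
      exact Real.rpow_le_rpow hN.le hle hs0
    refine (he.integral_sq_le hδ zero_le_one (hM N) fun n => ?_).trans ?_
    · rw [one_mul]
      refine (errChaosNormSq_le_chaosNormSq hδ n _).trans
        (le_mul_of_one_le_left (chaosNormSq_nonneg _ _ _) ?_)
      exact Real.one_le_rpow (by simp) hs0
    · rw [mul_right_comm]
      gcongr
      rw [add_mul]
      exact h1.trans (le_add_of_nonneg_left (by positivity))
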